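/- For a group $E$ and a field $F$, an $E$-extension of $F$ is a Galois extension $L/F$, inside a fixed algebraic closure $\bar F$ of $F$, with $\mathrm{Gal}(L/F)\simeq E$. Let $\nu(E,F)$ be the number (possibly infinite) of distinct $E$-extensions of $F$ inside $\bar F$, and let the realization multiplicity of $E$ be $\nu(E)=\min\{\nu(E,F) : F \text{ a field with } \nu(E,F)\ge 1\}$. Let $p$ be a prime, let $n\ge 1$ be an integer, with $n\ge 2$ when $p=2$, and let $k\ge 0$ be an integer. Write $G=\mathbb{Z}/p^n\mathbb{Z}$ and let $\mathbb{F}_p[G]^k\rtimes G$ be the semidirect product in which $G$ acts on each copy of the group ring $\mathbb{F}_p[G]$ by multiplication by group elements. Then $$\nu\left(\mathbb{F}_p[G]^k\rtimes G\right)\ \ge\ p^k .$$ Moreover, let $F$ be any field, $K\subseteq\bar F$ a Galois extension of $F$ and $\varphi:\mathrm{Gal}(K/F)\to G$ an isomorphism. Call a Galois extension $L/F$ with $K\subseteq L\subseteq\bar F$ a solution of the embedding problem $\mathbb{F}_p[G]^k\rtimes G\to G\simeq\mathrm{Gal}(K/F)$ if there is an isomorphism $\psi:\mathrm{Gal}(L/F)\to\mathbb{F}_p[G]^k\rtimes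 G$ such that $\pi\circ\psi=\varphi\circ\mathrm{res}_{L/K}$, where $\pi:\mathbb{F}_p[G]^k\rtimes G\to G$ is the canonical projection and $\mathrm{res}_{L/K}:\mathrm{Gal}(L/F)\to\mathrm{Gal}(K/F)$ is restriction. If this embedding problem has at least one solution, then it has at least $p^k$ distinct solutions $L$. -/

import Mathlib

universe u

/-- `L` is a `G`-extension of `F`: an extension of `F` inside the fixed algebraic closure of `F`
which is Galois over `F` with Galois group isomorphic to `G`. -/
def IsGExtension (G : Type*) [Group G] (F : Type*) [Field F]
    (L : IntermediateField F (AlgebraicClosure F)) : Prop :=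
  IsGalois F L ∧ Nonempty (Gal(L/F) ≃* G)

/-- `ν(G, F)`: the number (possibly infinite) of distinct `G`-extensions of `F` inside the fixed
algebraic closure of `F`. -/
noncomputable def extensionCount (G : Type*) [Group G] (F : Type*) [Field F] : ℕ∞ :=
  Set.encard {L : IntermediateField F (AlgebraicClosure F) | IsGExtension G F L}

/-- `F` belongs to the class `𝔉(G)` of fields with at least one `G`-extension. -/
def Realizes (G : Type*) [Group G] (F : Type*) [Field F] : Prop :=
  1 ≤ extensionCount G F

/-- The realization multiplicity `ν(G)`: the minimum of `ν(G, F)` over all fields `F` having at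
least one `G`-extension. For a finite group the set below is nonempty (see
`exists_realizes`), so that the infimum in the well-ordered set `ℕ∞` is a minimum. -/
noncomputable def realizationMultiplicity.{w, v} (G : Type v) [Group G] : ℕ∞ :=
  sInf {m : ℕ∞ | ∃ (F : Type w) (_ : Field F), Realizes G F ∧ m = extensionCount G F}

/-- Every finite group is a Galois group over some field, in every universe. -/
theorem exists_realizes.{w, v} (G : Type v) [Group G] [Finite G] :
    ∃ (F : Type w) (_ : Field F), Realizes G F := by
  classical
  -- a copy of `G` in the right universe, and the permutations of variables of `ℚ(x_g : g ∈ G)`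
  obtain ⟨m, ⟨e⟩⟩ := Finite.exists_equiv_fin G
  let ι : Type w := ULift.{w} (Fin m)
  let e' : G ≃ ι := e.trans Equiv.ulift.symm
  let A := MvPolynomial ι ℚ
  let L := FractionRing A
  let f₀ : G →* Equiv.Perm ι := e'.permCongrHom.toMonoidHom.comp (MulAction.toPermHom G G)
  have hf₀ : Function.Injective f₀ :=
    e'.permCongrHom.injective.comp MulAction.toPerm_injective
  let f₁ : Equiv.Perm ι →* (A ≃+* A) :=
    { toFun := fun s => (MvPolynomial.renameEquiv ℚ s).toRingEquiv
      map_one' := by ext x; simp [A]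
      map_mul' := fun s t => by
        apply RingEquiv.ext
        intro x
        simp [A, MvPolynomial.rename_rename] }
  have hf₁ : Function.Injective f₁ := by
    intro s t h
    ext i : 1
    have := congrArg (fun r : A ≃+* A => r (MvPolynomial.X i)) h
    change (MvPolynomial.rename s) (MvPolynomial.X i : A) =
      (MvPolynomial.rename t) (MvPolynomial.X i : A) at this
    rw [MvPolynomial.rename_X, MvPolynomial.rename_X] at this
    exact MvPolynomial.X_injective this
  let f₂ : (A ≃+* A) →* (L ≃+* L) := IsFractionRing.ringEquivOfRingEquivHom A L
  have hf₂ : Function.Injective f₂ := by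
    intro s t h
    apply RingEquiv.ext
    intro b
    have := congrArg (fun r : L ≃+* L => r (algebraMap A L b)) h
    exact IsFractionRing.injective A L (by simpa [f₂] using this)
  let : MulSemiringAction G L := MulSemiringAction.compHom L (f₂.comp (f₁.comp f₀))
  have : FaithfulSMul G L := ⟨fun {g h} H =>
    hf₀ (hf₁ (hf₂ (RingEquiv.ext H)))⟩
  let F := FixedPoints.subfield G L
  have : IsGalois F L := IsGaloisGroup.isGalois G F L
  let j : L →ₐ[F] AlgebraicClosure F := IsAlgClosed.lift
  let j' : L ≃ₐ[F] j.fieldRange := AlgEquiv.ofInjectiveField j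
  refine ⟨F, inferInstance, ?_⟩
  have hmem : j.fieldRange ∈
      {M : IntermediateField F (AlgebraicClosure F) | IsGExtension G F M} :=
    ⟨IsGalois.of_algEquiv j',
      ⟨(AlgEquiv.autCongr j').symm.trans (FixedPoints.toAlgAutMulEquiv G L).symm⟩⟩
  exact Set.one_le_encard_iff_nonempty.2 ⟨_, hmem⟩

/-- The action of `G` on the free module `R[G]^k`, where `g` acts on each coordinate as
multiplication by the group element `g ∈ R[G]`; the additive group `R[G]^k` is written
multiplicatively. -/
noncomputable def freeModuleAction (R G : Type*) [Ring R] [Group G] (k : ℕ) :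
    G →* MulAut (Multiplicative (Fin k → MonoidAlgebra R G)) where
  toFun g :=
    { toFun := fun v => Multiplicative.ofAdd fun i => MonoidAlgebra.of R G g * v.toAdd i
      invFun := fun v => Multiplicative.ofAdd fun i => MonoidAlgebra.of R G g⁻¹ * v.toAdd i
      left_inv := fun v => by
        apply Multiplicative.toAdd.injective
        funext i
        simp only [toAdd_ofAdd]
        rw [← mul_assoc, ← map_mul, inv_mul_cancel, map_one, one_mul]
      right_inv := fun v => by
        apply Multiplicative.toAdd.injective
        funext i
        simp only [toAdd_ofAdd]
        rw [← mul_assoc, ← map_mul, mul_inv_cancel, map_one, one_mul]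
      map_mul' := fun v w => by
        apply Multiplicative.toAdd.injective
        funext i
        simp only [toAdd_mul, toAdd_ofAdd, Pi.add_apply, mul_add] }
  map_one' := by
    apply MulEquiv.ext
    intro v
    apply Multiplicative.toAdd.injective
    funext i
    exact (congrArg (· * v.toAdd i) (map_one (MonoidAlgebra.of R G))).trans (one_mul _)
  map_mul' g h := by
    apply MulEquiv.ext
    intro v
    apply Multiplicative.toAdd.injective
    funext i
    exact (congrArg (· * v.toAdd i) (map_mul (MonoidAlgebra.of R G) g h)).trans
      (mul_assoc _ _ _)

/-- The semidirect product `R[G]^k ⋊ G`. -/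
abbrev FreeModuleSemidirect (R G : Type*) [Ring R] [Group G] (k : ℕ) : Type _ :=
  Multiplicative (Fin k → MonoidAlgebra R G) ⋊[freeModuleAction R G k] G

/-- The cyclic group `ℤ/p^nℤ`, written multiplicatively. -/
abbrev CyclicPPow (p n : ℕ) : Type := Multiplicative (ZMod (p ^ n))

/-- `L/F` is a (proper) solution of the embedding problem `π : E → G` over the `G`-extension `K/F`
with identification `φ : Gal(K/F) ≃ G`: the field `L` contains `K`, is Galois over `F`, and there
is an isomorphism `ψ : Gal(L/F) ≃ E` for which the restriction `Gal(L/F) → Gal(K/F)` corresponds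
to `π`, that is, each `τ ∈ Gal(L/F)` acts on `K` as `φ⁻¹(π(ψ(τ)))`. -/
def SolvesEmbeddingProblem {E G : Type*} [Group E] [Group G] (π : E →* G)
    {F : Type*} [Field F] (K : IntermediateField F (AlgebraicClosure F)) (φ : Gal(K/F) ≃* G)
    (L : IntermediateField F (AlgebraicClosure F)) : Prop :=
  IsGalois F L ∧ ∃ hKL : K ≤ L, ∃ ψ : Gal(L/F) ≃* E, ∀ (τ : Gal(L/F)) (x : K),
    τ (IntermediateField.inclusion hKL x) =
      IntermediateField.inclusion hKL (φ.symm (π (ψ τ)) x)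

/-! Let `Ω` be the Galois group of the separable closure, `Ψ` a surjection of `Ω` onto `𝔽_p[G]^k ⋊
G`, and `X` the kernel of its projection to `G`. Extensions correspond to open kernels, so the aim
is to find `p ^ k` such surjections with the same projection and distinct kernels. The group `H` of
continuous characters `X → 𝔽_p` is a `G`-module by conjugation.

Twisting: the coefficients of `Ψ` at `1 ∈ G` give characters `w_i` of `X`, and any `k` characters of
`X` induce a homomorphism to the semidirect product, as in Shapiro's lemma. Replace `w_i` by `w_i +
c_i u`. If `u` has norm zero over `G`, the augmentations do not change, so Nakayama's lemma for the
local ring `𝔽_p[G]` preserves surjectivity. If also `u` is nonzero on `Ψ.ker`, the `p ^ k` kernels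
differ (`exists_family_of_norm_eq_zero`).

Existence of `u`: if all norm-zero characters vanished on `Ψ.ker`, then all characters would, and
`H` would be the dual of a free `𝔽_p[G]`-module, hence cohomologically trivial. It is enough to
refute this for one `t` of order `p` modulo `X`, by a `t`-invariant character that is not a norm
along `t` (`exists_character_norm_eq_zero`).

Arithmetic (`exists_hasInvariantNonNorm`): norms along `t` vanish at `t ^ p`, so an invariant
character nonzero there suffices. In characteristic `p` Artin-Schreier theory supplies one.
Otherwise pass to `Y = X ⊓ χ.ker`, with `χ` the cyclotomic character, and return by corestriction,
as the index is prime to `p`. By Hilbert 90 and Kummer theory, an element fixed by `Y` whose norm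
along `t` is a nontrivial `p`-th root of unity supplies one. If all invariant characters were norms,
the Kummer character of a `p`-th root of `ζ` (`p` odd), or of a square root of some `α` with `t₀ α =
-α` and `t = t₀ ^ 2` (`p = 2`), would produce such an element, a contradiction. The case `p = 2`
needs `t₀` of order `4` modulo `X`, whence `n ≥ 2`. -/

/-- A continuous character of the subgroup `X` with values in `ZMod p`, given by a function on the
whole group whose values outside `X` are irrelevant. -/
def IsCharacter (p : ℕ) {Ω : Type*} [Group Ω] [TopologicalSpace Ω] (X : Subgroup Ω)
    (u : Ω → ZMod p) : Prop :=
  (∀ g ∈ X, ∀ h ∈ X, u (g * h) = u g + u h) ∧ IsOpen {h | h ∈ X ∧ u h = 0}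

/-! ### Continuous characters of subgroups, conjugation and corestriction -/

namespace IsCharacter

/-- The norm of a character under `t` vanishes at `t ^ p`. -/
theorem sum_conj_pow_eq_zero {p : ℕ} {Ω : Type*} [Group Ω] (v : Ω → ZMod p) (t : Ω) :
    ∑ j ∈ Finset.range p, v ((t ^ j)⁻¹ * t ^ p * t ^ j) = 0 := by
  have : ∀ j, (t ^ j)⁻¹ * t ^ p * t ^ j = t ^ p := fun j => by
    rw [mul_assoc, ← pow_add, add_comm, pow_add, inv_mul_cancel_left]
  simp [this]

variable {p : ℕ} {Ω : Type*} [Group Ω] [TopologicalSpace Ω] {X : Subgroup Ω} {u v : Ω → ZMod p}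

theorem map_one (hu : IsCharacter p X u) : u 1 = 0 := by
  have := hu.1 1 X.one_mem 1 X.one_mem
  simpa using this

theorem map_inv (hu : IsCharacter p X u) {g : Ω} (hg : g ∈ X) : u g⁻¹ = -u g := by
  have := hu.1 g⁻¹ (X.inv_mem hg) g hg
  rw [inv_mul_cancel, hu.map_one] at this
  exact eq_neg_of_add_eq_zero_left this.symm

theorem map_pow (hu : IsCharacter p X u) {g : Ω} (hg : g ∈ X) (n : ℕ) : u (g ^ n) = n * u g := by
  induction n with
  | zero => simp [hu.map_one]
  | succ n ih => rw [pow_succ, hu.1 _ (X.pow_mem hg n) _ hg, ih]; push_cast; ring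

theorem map_conj (hu : IsCharacter p X u) {g h : Ω} (hg : g ∈ X) (hh : h ∈ X) :
    u (g⁻¹ * h * g) = u h := by
  rw [hu.1 _ (X.mul_mem (X.inv_mem hg) hh) _ hg, hu.1 _ (X.inv_mem hg) _ hh, hu.map_inv hg]
  ring

/-- Inner conjugation is trivial on characters, so the conjugation action factors through the
quotient by `X`. This allows norms written with a section to be reindexed. -/
theorem conj_eq_of_inv_mul_mem {X : Subgroup Ω} [X.Normal] {v : Ω → ZMod p}
    (hv : IsCharacter p X v) {a b h : Ω} (hab : a⁻¹ * b ∈ X) (hh : h ∈ X) :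
    v (a⁻¹ * h * a) = v (b⁻¹ * h * b) := by
  have h1 : a⁻¹ * h * a ∈ X := by simpa using Subgroup.Normal.conj_mem ‹_› h hh a⁻¹
  rw [← hv.map_conj hab h1]
  congr 1
  group

/-- By translation, continuity need only be checked near `1`; `Z` need not be a subgroup. -/
theorem of_open [IsTopologicalGroup Ω] (hadd : ∀ g ∈ X, ∀ h ∈ X, u (g * h) = u g + u h) {Z : Set Ω}
    (hZ : IsOpen Z) (h1 : 1 ∈ Z) (hZu : ∀ h ∈ Z, h ∈ X ∧ u h = 0) : IsCharacter p X u := by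
  refine ⟨hadd, isOpen_iff_mem_nhds.2 fun a ha => ?_⟩
  have hopen : IsOpen ((fun x => a⁻¹ * x) ⁻¹' Z) := hZ.preimage (continuous_const_mul _)
  refine Filter.mem_of_superset (hopen.mem_nhds (by simpa using h1)) fun x hx => ?_
  obtain ⟨hx1, hx2⟩ := hZu _ hx
  have hxa : x = a * (a⁻¹ * x) := by group
  refine ⟨?_, ?_⟩
  · rw [hxa]; exact X.mul_mem ha.1 hx1
  · rw [hxa, hadd _ ha.1 _ hx1, ha.2, hx2, add_zero]

theorem add [IsTopologicalGroup Ω] (hu : IsCharacter p X u) (hv : IsCharacter p X v) :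
    IsCharacter p X fun h => u h + v h := by
  refine of_open ?_ (hu.2.inter hv.2) ⟨⟨X.one_mem, hu.map_one⟩, X.one_mem, hv.map_one⟩ ?_
  · intro g hg h hh
    rw [hu.1 g hg h hh, hv.1 g hg h hh]; ring
  · rintro h ⟨⟨h1, h2⟩, -, h3⟩
    exact ⟨h1, by rw [h2, h3, add_zero]⟩

theorem const_mul [IsTopologicalGroup Ω] (hu : IsCharacter p X u) (c : ZMod p) :
    IsCharacter p X fun h => c * u h := by
  refine of_open ?_ hu.2 ⟨X.one_mem, hu.map_one⟩ ?_
  · intro g hg h hh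
    rw [hu.1 g hg h hh]; ring
  · rintro h ⟨h1, h2⟩
    exact ⟨h1, by rw [h2, mul_zero]⟩

theorem sub [IsTopologicalGroup Ω] (hu : IsCharacter p X u) (hv : IsCharacter p X v) :
    IsCharacter p X fun h => u h - v h := by
  have := hu.add (hv.const_mul (-1))
  simpa [sub_eq_add_neg] using this

theorem conj [IsTopologicalGroup Ω] [X.Normal] (hu : IsCharacter p X u) (c : Ω) :
    IsCharacter p X fun h => u (c⁻¹ * h * c) := by
  have hX : ∀ h ∈ X, c⁻¹ * h * c ∈ X := fun h hh => by
    simpa using Subgroup.Normal.conj_mem ‹_› h hh c⁻¹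
  refine of_open (Z := (fun x => c⁻¹ * x * c) ⁻¹' {h | h ∈ X ∧ u h = 0}) ?_ ?_ ?_ ?_
  · intro g hg h hh
    rw [← hu.1 _ (hX g hg) _ (hX h hh)]
    congr 1; group
  · exact hu.2.preimage (by fun_prop)
  · simpa using hu.map_one
  · rintro h ⟨h1, h2⟩
    refine ⟨?_, h2⟩
    have := Subgroup.Normal.conj_mem ‹_› _ h1 c
    simpa [mul_assoc] using this

/-- Moving all factors `t` to the left costs only conjugations by `t`, invisible to `u`; what
remains contributes `p * u b = 0`. -/
theorem map_mul_pow [X.Normal] (hu : IsCharacter p X u) {t b : Ω} (hb : b ∈ X)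
    (htp : t ^ p ∈ X) (hinv : ∀ h ∈ X, u (t⁻¹ * h * t) = u h) : u ((t * b) ^ p) = u (t ^ p) := by
  have key : ∀ i : ℕ, ∃ c ∈ X, (t * b) ^ i = t ^ i * c ∧ u c = i * u b := by
    intro i
    induction i with
    | zero => exact ⟨1, X.one_mem, by simp, by simp [hu.map_one]⟩
    | succ i ih =>
      obtain ⟨c, hc, h1, h2⟩ := ih
      have hc' : t⁻¹ * c * t ∈ X := by
        simpa using Subgroup.Normal.conj_mem ‹_› c hc t⁻¹
      refine ⟨t⁻¹ * c * t * b, X.mul_mem hc' hb, ?_, ?_⟩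
      · rw [pow_succ, h1, pow_succ]; group
      · rw [hu.1 _ hc' _ hb, hinv c hc, h2]; push_cast; ring
  obtain ⟨c, hc, h1, h2⟩ := key p
  rw [h1, hu.1 _ htp _ hc, h2]; simp

open Classical in
/-- Corestriction of a `t`-invariant character from a subgroup of index prime to `p`. -/
theorem exists_transfer [Fact p.Prime] [IsTopologicalGroup Ω] {M : Type*} [CommGroup M] [Fintype M]
    (hM : (Fintype.card M).Coprime p) (χ : Ω →* M) (X : Subgroup Ω) [X.Normal] {t : Ω}
    (htχ : χ t = 1) (htp : t ^ p ∈ X) (hu : IsCharacter p (X ⊓ χ.ker) u)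
    (hinv : ∀ h ∈ X ⊓ χ.ker, u (t⁻¹ * h * t) = u h) :
    ∃ (U : Ω → ZMod p) (d : ℕ), d.Coprime p ∧ IsCharacter p X U ∧
      (∀ h ∈ X, U (t⁻¹ * h * t) = U h) ∧ U (t ^ p) = d * u (t ^ p) ∧
      ∀ h ∈ X ⊓ χ.ker, (∀ c ∈ X, u (c⁻¹ * h * c) = u h) → U h = d * u h := by
  have hconj : ∀ c, ∀ h ∈ X, c⁻¹ * h * c ∈ X := fun c h hh => by
    simpa using Subgroup.Normal.conj_mem ‹_› h hh c⁻¹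
  have hconjY : ∀ c, ∀ h ∈ X ⊓ χ.ker, c⁻¹ * h * c ∈ X ⊓ χ.ker := fun c h hh => by
    refine ⟨hconj c h hh.1, ?_⟩
    have : χ h = 1 := hh.2
    simp [this]
  have hs : ∀ q : M, ∃ s : Ω, q ∈ X.map χ → s ∈ X ∧ χ s = q := fun q => by
    by_cases hq : q ∈ X.map χ
    · obtain ⟨s, hs⟩ := hq
      exact ⟨s, fun _ => hs⟩
    · exact ⟨1, fun h => absurd h hq⟩
  choose s hs using hs
  set Q : Finset M := Finset.univ.filter (· ∈ X.map χ) with hQ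
  have memQ : ∀ q, q ∈ Q ↔ q ∈ X.map χ := by simp [hQ]
  have hsX : ∀ q ∈ Q, s q ∈ X := fun q hq => (hs q ((memQ q).1 hq)).1
  have hsχ : ∀ q ∈ Q, χ (s q) = q := fun q hq => (hs q ((memQ q).1 hq)).2
  have hmul : ∀ x ∈ X, ∀ q ∈ Q, (χ x)⁻¹ * q ∈ Q := fun x hx q hq => by
    rw [memQ] at hq ⊢
    exact mul_mem (inv_mem (Subgroup.mem_map_of_mem _ hx)) hq
  have hmem : ∀ x ∈ X, ∀ q ∈ Q, (s q)⁻¹ * x * s ((χ x)⁻¹ * q) ∈ X ⊓ χ.ker := fun x hx q hq => by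
    refine Subgroup.mem_inf.2
      ⟨mul_mem (mul_mem (inv_mem (hsX q hq)) hx) (hsX _ (hmul x hx q hq)), ?_⟩
    rw [MonoidHom.mem_ker]
    simp [hsχ q hq, hsχ _ (hmul x hx q hq)]
  -- The transfer formula: `Q = χ(X)` indexes the cosets of `X ⊓ χ.ker` in `X`, with representatives
  -- `s q`.
  let U : Ω → ZMod p := fun x => ∑ q ∈ Q, u ((s q)⁻¹ * x * s ((χ x)⁻¹ * q))
  have hUadd : ∀ x ∈ X, ∀ y ∈ X, U (x * y) = U x + U y := by
    intro x hx y hy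
    have h1 : U y = ∑ q ∈ Q, u ((s ((χ x)⁻¹ * q))⁻¹ * y * s ((χ y)⁻¹ * ((χ x)⁻¹ * q))) := by
      refine (Finset.sum_bij' (fun q _ => (χ x)⁻¹ * q) (fun q _ => χ x * q)
        (fun q hq => hmul x hx q hq) (fun q hq => ?_) ?_ ?_ ?_).symm
      · have := hmul x⁻¹ (inv_mem hx) q hq
        simpa using this
      · simp
      · simp
      · intros; rfl
    rw [h1, ← Finset.sum_add_distrib]
    refine Finset.sum_congr rfl fun q hq => ?_
    rw [← hu.1 _ (hmem x hx q hq) _ (hmem y hy _ (hmul x hx q hq))]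
    congr 1
    simp only [_root_.map_mul, mul_inv_rev]
    group
  have hUY : ∀ h ∈ X ⊓ χ.ker, U h = ∑ q ∈ Q, u ((s q)⁻¹ * h * s q) := fun h hh => by
    have : χ h = 1 := hh.2
    simp [U, this]
  have hU : IsCharacter p X U := by
    refine of_open (Z := ⋂ q ∈ insert 1 Q, (fun x => (s q)⁻¹ * x * s q) ⁻¹'
      {h | h ∈ X ⊓ χ.ker ∧ u h = 0}) hUadd ?_ ?_ ?_
    · exact isOpen_biInter_finset fun q _ => hu.2.preimage (by fun_prop)
    · simp [hu.map_one]
    · intro h hh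
      simp only [Set.mem_iInter, Set.mem_preimage, Set.mem_ofPred_eq] at hh
      have hY : h ∈ X ⊓ χ.ker := by
        have := hconjY (s 1)⁻¹ _ (hh 1 (Finset.mem_insert_self _ _)).1
        simpa [mul_assoc] using this
      refine ⟨hY.1, ?_⟩
      rw [hUY h hY]
      exact Finset.sum_eq_zero fun q hq => (hh q (Finset.mem_insert_of_mem hq)).2
  have hcomm : ∀ c ∈ X, c⁻¹ * t⁻¹ * c * t ∈ X := fun c hc => by
    have := mul_mem (inv_mem hc) (hconj t c hc)
    simpa [mul_assoc] using this
  have hUinvY : ∀ h ∈ X ⊓ χ.ker, U (t⁻¹ * h * t) = U h := fun h hh => by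
    rw [hUY h hh, hUY _ (hconjY t h hh)]
    refine Finset.sum_congr rfl fun q hq => ?_
    have hb : (s q)⁻¹ * t⁻¹ * (s q) * t ∈ X ⊓ χ.ker :=
      ⟨hcomm _ (hsX q hq), by simp [htχ]⟩
    have h2 := hconjY (s q) h hh
    have := hu.map_conj (inv_mem hb) (hconjY t _ h2)
    rw [hinv _ h2] at this
    rw [← this]
    congr 1
    group
  have hM0 : ((Fintype.card M : ℕ) : ZMod p) ≠ 0 := by
    intro h
    rw [ZMod.natCast_eq_zero_iff] at h
    exact (Fact.out : p.Prime).one_lt.ne' (Nat.Coprime.eq_one_of_dvd hM.symm h)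
  have htY : t ^ p ∈ X ⊓ χ.ker := ⟨htp, by simp [htχ]⟩
  have hQc : Q.card ∣ Fintype.card M := by
    have h1 : Q.card = Nat.card (X.map χ) := by
      rw [Nat.card_eq_fintype_card, hQ]
      exact (Fintype.card_subtype _).symm
    rw [h1, ← Nat.card_eq_fintype_card]
    exact Subgroup.card_subgroup_dvd_card _
  refine ⟨U, Q.card, Nat.Coprime.coprime_dvd_left hQc hM, hU, ?_, ?_, ?_⟩
  · intro h hh
    -- Invariance passes from `X ⊓ χ.ker` to `X`, because the power lies in the smaller group and
    -- the exponent is invertible modulo `p`.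
    have hpow : h ^ Fintype.card M ∈ X ⊓ χ.ker := ⟨pow_mem hh _, by simp⟩
    have := hUinvY _ hpow
    rw [hU.map_pow hh, show t⁻¹ * h ^ Fintype.card M * t = (t⁻¹ * h * t) ^ Fintype.card M by
      simpa using (conj_pow (a := t⁻¹) (b := h) (i := Fintype.card M)).symm,
      hU.map_pow (hconj t h hh)] at this
    exact mul_left_cancel₀ hM0 this
  · rw [hUY _ htY, ← nsmul_eq_mul, ← Finset.sum_const]
    refine Finset.sum_congr rfl fun q hq => ?_
    -- The conjugate of `t` by `s q` is `t * b` with `b` in `X ⊓ χ.ker`, so `map_mul_pow` makes all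
    -- summands equal.
    have hb : t⁻¹ * ((s q)⁻¹ * t * (s q)) ∈ X ⊓ χ.ker := by
      refine ⟨?_, by simp [htχ]⟩
      have := hconj t _ (inv_mem (hsX q hq))
      simpa [mul_assoc] using mul_mem this (hsX q hq)
    rw [← hu.map_mul_pow hb htY hinv]
    congr 1
    rw [mul_inv_cancel_left]
    simpa using (conj_pow (a := (s q)⁻¹) (b := t) (i := p)).symm
  · intro h hh hc
    rw [hUY h hh, ← nsmul_eq_mul, ← Finset.sum_const]
    exact Finset.sum_congr rfl fun q hq => hc _ (hsX q hq)

theorem mono {Y : Subgroup Ω} (hu : IsCharacter p X u) (hYX : Y ≤ X) (hY : IsOpen (Y : Set Ω)) :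
    IsCharacter p Y u := by
  refine ⟨fun g hg h hh => hu.1 g (hYX hg) h (hYX hh), ?_⟩
  convert hY.inter hu.2 using 1
  ext h
  exact ⟨fun ⟨h1, h2⟩ => ⟨h1, hYX h1, h2⟩, fun ⟨h1, _, h2⟩ => ⟨h1, h2⟩⟩

end IsCharacter

/-! ### Independence of automorphisms and Hilbert 90 -/

section GaloisAction

variable {F S : Type*} [Field F] [Field S] [Algebra F S]

theorem galois_pow_succ_apply (t : Gal(S/F)) (i : ℕ) (x : S) : t ((t ^ i) x) = (t ^ (i + 1)) x := by
  rw [pow_succ', AlgEquiv.mul_apply]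

theorem fixed_apply_of_normal {Y : Subgroup Gal(S/F)} [Y.Normal] {x : S}
    (hx : ∀ h ∈ Y, h x = x) (c : Gal(S/F)) : ∀ h ∈ Y, h (c x) = c x := fun h hh => by
  have h1 : c⁻¹ * h * c ∈ Y := by simpa using Subgroup.Normal.conj_mem ‹_› h hh c⁻¹
  have h2 := congrArg c (hx _ h1)
  rwa [← AlgEquiv.mul_apply, show c * (c⁻¹ * h * c) = h * c by group, AlgEquiv.mul_apply] at h2

/-- The norm along `t` is `t`-invariant. -/
theorem apply_prod_pow_apply {t : Gal(S/F)} {p : ℕ} {x : S} (hx : (t ^ p) x = x) :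
    t (∏ i ∈ Finset.range p, (t ^ i) x) = ∏ i ∈ Finset.range p, (t ^ i) x := by
  rw [map_prod]
  simp only [galois_pow_succ_apply]
  have h1 := Finset.prod_range_succ (fun i => (t ^ i) x) p
  have h2 := Finset.prod_range_succ' (fun i => (t ^ i) x) p
  simp only [hx, pow_zero, AlgEquiv.one_apply] at h1 h2
  by_cases h0 : x = 0
  · subst h0; simp
  · exact mul_right_cancel₀ h0 (h2.symm.trans h1)

theorem apply_sum_pow_apply {t : Gal(S/F)} {p : ℕ} {x : S} (hx : (t ^ p) x = x) :
    t (∑ i ∈ Finset.range p, (t ^ i) x) = ∑ i ∈ Finset.range p, (t ^ i) x := by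
  rw [map_sum]
  simp only [galois_pow_succ_apply]
  have h1 := Finset.sum_range_succ (fun i => (t ^ i) x) p
  have h2 := Finset.sum_range_succ' (fun i => (t ^ i) x) p
  simp only [hx, pow_zero, AlgEquiv.one_apply] at h1 h2
  exact add_right_cancel (h2.symm.trans h1)

theorem galois_pow_apply_of_apply {t : Gal(S/F)} {x : S} (hx : t x = x) (i : ℕ) :
    (t ^ i) x = x := by
  induction i with
  | zero => rfl
  | succ i ih => rw [← galois_pow_succ_apply, ih, hx]

theorem pow_notMem_of_prime {Ω : Type*} [Group Ω] {p : ℕ} (hp : p.Prime) {X : Subgroup Ω} {t : Ω}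
    (ht : t ∉ X) (htp : t ^ p ∈ X) {i : ℕ} (h0 : 0 < i) (hi : i < p) : t ^ i ∉ X := by
  intro h
  apply ht
  have hc : Nat.gcd i p = 1 := Nat.Coprime.symm
    ((Nat.Prime.coprime_iff_not_dvd hp).2 (Nat.not_dvd_of_pos_of_lt h0 hi))
  have h1 := Nat.gcd_eq_gcd_ab i p
  rw [hc] at h1
  have h2 : t = (t ^ i) ^ (Nat.gcdA i p) * (t ^ p) ^ (Nat.gcdB i p) := by
    rw [← zpow_natCast, ← zpow_natCast, ← zpow_mul, ← zpow_mul, ← zpow_add, ← h1]; simp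
  rw [h2]
  exact mul_mem (zpow_mem h _) (zpow_mem htp _)

/-- Independence of the powers of `t` on the fixed field of `Y`. -/
theorem exists_fixed_sum_ne_zero [IsGalois F S] {Y : Subgroup Gal(S/F)}
    (hY : IsOpen (Y : Set Gal(S/F))) {t : Gal(S/F)} {m : ℕ} (hm : 0 < m)
    (ht : ∀ i, 0 < i → i < m → t ^ i ∉ Y) (a : ℕ → S) (ha : a 0 ≠ 0) :
    ∃ x : S, (∀ h ∈ Y, h x = x) ∧ ∑ i ∈ Finset.range m, a i * (t ^ i) x ≠ 0 := by
  let K := IntermediateField.fixedField Y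
  let f : Fin m → (K →* S) := fun i =>
    (((t ^ (i : ℕ) : Gal(S/F)) : S →+* S) : S →* S).comp (algebraMap K S : K →* S)
  have hfix : K.fixingSubgroup = Y :=
    InfiniteGalois.fixingSubgroup_fixedField ⟨Y, Y.isClosed_of_isOpen hY⟩
  have key : ∀ i j : Fin m, i < j → f i ≠ f j := by
    intro i j hij h
    refine ht (j - i) (Nat.sub_pos_of_lt hij) (lt_of_le_of_lt (Nat.sub_le _ _) j.2) ?_
    rw [← hfix, IntermediateField.mem_fixingSubgroup_iff]
    intro x hx
    have h1 : (t ^ (i : ℕ)) x = (t ^ (j : ℕ)) x := DFunLike.congr_fun h (⟨x, hx⟩ : K)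
    have h2 : (j : ℕ) = i + (j - i) := by
      have : (i : ℕ) < j := hij
      omega
    rw [h2, pow_add, AlgEquiv.mul_apply] at h1
    exact ((t ^ (i : ℕ)).injective h1).symm
  have hinj : Function.Injective f := by
    intro i j h
    rcases lt_trichotomy i j with hij | hij | hij
    · exact absurd h (key i j hij)
    · exact hij
    · exact absurd h.symm (key j i hij)
  -- Dedekind's independence of characters, applied to the distinct restrictions of the powers of
  -- `t` to `K`.
  have hli := (linearIndependent_monoidHom K S).comp f hinj
  by_contra! hcon
  have h0 := Fintype.linearIndependent_iff.1 hli (fun i => a i) (by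
    ext x
    have := hcon x ((IntermediateField.mem_fixedField_iff _ _).1 x.2)
    rw [← Fin.sum_univ_eq_sum_range (fun i => a i * (t ^ i) (x : S))] at this
    simpa [f] using this) ⟨0, hm⟩
  exact ha h0

/-- Hilbert's Theorem 90 for the group generated by `t` modulo `Y`. -/
theorem exists_mul_apply_eq_of_prod_eq_one [IsGalois F S] {Y : Subgroup Gal(S/F)} [Y.Normal]
    (hY : IsOpen (Y : Set Gal(S/F))) {t : Gal(S/F)} {m : ℕ} (hm : 0 < m) (htm : t ^ m ∈ Y)
    (ht : ∀ i, 0 < i → i < m → t ^ i ∉ Y) {b : S} (hb : ∀ h ∈ Y, h b = b)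
    (hN : ∏ i ∈ Finset.range m, (t ^ i) b = 1) :
    ∃ γ : S, γ ≠ 0 ∧ (∀ h ∈ Y, h γ = γ) ∧ b * t γ = γ := by
  -- Partial norms of `b`: in the sum of `c i * (t ^ i) x`, applying `t` and multiplying by `b`
  -- shifts the index, and `c m = 1 = c 0` closes the cycle.
  let c : ℕ → S := fun i => ∏ l ∈ Finset.range i, (t ^ l) b
  obtain ⟨x, hx, hne⟩ := exists_fixed_sum_ne_zero hY hm ht c (by simp [c])
  refine ⟨_, hne, ?_, ?_⟩
  · intro h hh
    rw [map_sum]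
    refine Finset.sum_congr rfl fun i _ => ?_
    rw [map_mul, fixed_apply_of_normal hx _ h hh, map_prod]
    congr 1
    exact Finset.prod_congr rfl fun l _ => fixed_apply_of_normal hb _ h hh
  · have hc : ∀ i, b * t (c i) = c (i + 1) := fun i => by
      simp only [c, map_prod, galois_pow_succ_apply]
      rw [Finset.prod_range_succ']
      simp [mul_comm]
    rw [map_sum, Finset.mul_sum]
    have h1 := Finset.sum_range_succ (fun i => c i * (t ^ i) x) m
    have h2 := Finset.sum_range_succ' (fun i => c i * (t ^ i) x) m
    have h3 : c m = 1 := hN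
    have h4 : c 0 = 1 := by simp [c]
    rw [h3, hx _ htm] at h1
    rw [h4, pow_zero, AlgEquiv.one_apply] at h2
    rw [add_right_cancel (h1.symm.trans h2)]
    refine Finset.sum_congr rfl fun i _ => ?_
    rw [map_mul, ← mul_assoc, hc, galois_pow_succ_apply]

end GaloisAction

/-- There is a `t`-invariant character of `X` which is not a norm along `t`. -/
def HasInvariantNonNorm (p : ℕ) {Ω : Type*} [Group Ω] [TopologicalSpace Ω] (X : Subgroup Ω)
    (t : Ω) : Prop :=
  ∃ u : Ω → ZMod p, IsCharacter p X u ∧ (∀ h ∈ X, u (t⁻¹ * h * t) = u h) ∧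
    ∀ v : Ω → ZMod p, IsCharacter p X v →
      ¬ ∀ h ∈ X, u h = ∑ j ∈ Finset.range p, v ((t ^ j)⁻¹ * h * t ^ j)

/-- The powers of `t` commute with `t ^ p`, so a norm takes there the value `p * v (t ^ p) = 0`. -/
theorem IsCharacter.hasInvariantNonNorm {p : ℕ} {Ω : Type*} [Group Ω] [TopologicalSpace Ω]
    {X : Subgroup Ω} {t : Ω} {u : Ω → ZMod p} (hu : IsCharacter p X u) (htp : t ^ p ∈ X)
    (hinv : ∀ h ∈ X, u (t⁻¹ * h * t) = u h) (hne : u (t ^ p) ≠ 0) :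
    HasInvariantNonNorm p X t :=
  ⟨u, hu, hinv, fun v _ h => hne ((h _ htp).trans (IsCharacter.sum_conj_pow_eq_zero v t))⟩

/-! ### Characteristic `p` -/

section ArtinSchreier

variable {F S : Type*} [Field F] [Field S] [Algebra F S] {p : ℕ}

/-- Independence gives an element of nonzero trace; the trace is `t`-invariant, so one may divide by
it. -/
theorem exists_fixed_trace_eq_one [Fact p.Prime] [IsGalois F S] {X : Subgroup Gal(S/F)} [X.Normal]
    (hX : IsOpen (X : Set Gal(S/F))) {t : Gal(S/F)} (ht : t ∉ X) (htp : t ^ p ∈ X) :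
    ∃ β : S, (∀ h ∈ X, h β = β) ∧ ∑ i ∈ Finset.range p, (t ^ i) β = 1 := by
  have hp := (Fact.out : p.Prime)
  obtain ⟨x, hx, hne⟩ := exists_fixed_sum_ne_zero hX hp.pos
    (fun i h0 hi => pow_notMem_of_prime hp ht htp h0 hi) (fun _ => 1) one_ne_zero
  simp only [one_mul] at hne
  have htr := apply_sum_pow_apply (hx _ htp)
  refine ⟨x / ∑ i ∈ Finset.range p, (t ^ i) x, fun h hh => ?_, ?_⟩
  · rw [map_div₀, hx h hh, map_sum]
    congr 1
    exact Finset.sum_congr rfl fun i _ => fixed_apply_of_normal hx _ h hh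
  · simp only [map_div₀, galois_pow_apply_of_apply htr]
    rw [← Finset.sum_div, div_self hne]

/-- Additive Hilbert 90, solved explicitly by weighting the conjugates of `β` with the partial
traces of `δ`. -/
theorem exists_sub_eq_of_trace_eq_zero {X : Subgroup Gal(S/F)} [X.Normal] {t : Gal(S/F)}
    (htp : t ^ p ∈ X) {β δ : S} (hβ : ∀ h ∈ X, h β = β)
    (hβ1 : ∑ i ∈ Finset.range p, (t ^ i) β = 1) (hδ : ∀ h ∈ X, h δ = δ)
    (hδ0 : ∑ i ∈ Finset.range p, (t ^ i) δ = 0) :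
    ∃ γ : S, (∀ h ∈ X, h γ = γ) ∧ t γ = γ + δ := by
  let c : ℕ → S := fun i => ∑ l ∈ Finset.range i, (t ^ l) δ
  refine ⟨-∑ i ∈ Finset.range p, c i * (t ^ i) β, fun h hh => ?_, ?_⟩
  · rw [map_neg, map_sum]
    congr 1
    refine Finset.sum_congr rfl fun i _ => ?_
    rw [map_mul, fixed_apply_of_normal hβ _ h hh, map_sum]
    congr 1
    exact Finset.sum_congr rfl fun l _ => fixed_apply_of_normal hδ _ h hh
  · have hc : ∀ i, t (c i) = c (i + 1) - δ := fun i => by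
      simp only [c, map_sum, galois_pow_succ_apply]
      rw [Finset.sum_range_succ']
      simp
    rw [map_neg, map_sum]
    have h1 := Finset.sum_range_succ (fun i => c i * (t ^ i) β) p
    have h2 := Finset.sum_range_succ' (fun i => c i * (t ^ i) β) p
    have h3 : c p = 0 := hδ0
    have h4 : c 0 = 0 := by simp [c]
    rw [h3, zero_mul, add_zero] at h1
    rw [h4, zero_mul, add_zero] at h2
    have h5 : ∑ i ∈ Finset.range p, t (c i * (t ^ i) β) =
        (∑ i ∈ Finset.range p, c (i + 1) * (t ^ (i + 1)) β) - δ := by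
      have h6 : ∑ i ∈ Finset.range p, (t ^ (i + 1)) β = 1 := by
        have := apply_sum_pow_apply (hβ _ htp)
        rw [map_sum, hβ1] at this
        simpa only [galois_pow_succ_apply] using this
      rw [← mul_one δ, ← h6, Finset.mul_sum, ← Finset.sum_sub_distrib]
      refine Finset.sum_congr rfl fun i _ => ?_
      rw [map_mul, hc, galois_pow_succ_apply, sub_mul]
    rw [h5, ← h2, h1]
    ring

/-- The polynomial has derivative `-1`, hence is separable. -/
theorem exists_artinSchreier_root [Fact p.Prime] [IsSepClosed S] [CharP S p] (γ : S) : ∃ y : S, y ^ p - y = γ := by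
  open Polynomial in
  have hp := (Fact.out : p.Prime)
  have hmon : (X ^ p - X - C γ : S[X]).natDegree = p := by
    rw [sub_sub]
    refine natDegree_sub_eq_left_of_natDegree_lt ?_ |>.trans (natDegree_X_pow p)
    rw [natDegree_X_pow]
    exact lt_of_le_of_lt (natDegree_add_C.le.trans natDegree_X_le) hp.one_lt
  obtain ⟨y, hy⟩ := IsSepClosed.exists_root (X ^ p - X - C γ : S[X])
    (fun h => by
      have := natDegree_eq_of_degree_eq_some h
      rw [hmon] at this
      exact hp.ne_zero this)
    (by
      rw [Separable]
      simp only [derivative_sub, derivative_X_pow, CharP.cast_eq_zero, map_zero, zero_mul,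
        derivative_X, derivative_C, sub_zero, zero_sub]
      exact (isCoprime_one_right).neg_right)
  refine ⟨y, ?_⟩
  simpa [sub_eq_zero] using hy

/-- In characteristic `p`, Artin-Schreier theory gives an invariant character which is not a
norm. -/
theorem hasInvariantNonNorm_of_charP [Fact p.Prime] [IsGalois F S] [IsSepClosed S] [CharP S p] {X : Subgroup Gal(S/F)} [X.Normal]
    (hX : IsOpen (X : Set Gal(S/F))) {t : Gal(S/F)} (ht : t ∉ X) (htp : t ^ p ∈ X) :
    HasInvariantNonNorm p X t := by
  have hp := (Fact.out : p.Prime)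
  let e : ZMod p →+* S := ZMod.castHom dvd_rfl S
  have he_inj : Function.Injective e := e.injective
  have he_fix : ∀ (τ : Gal(S/F)) a, τ (e a) = e a := fun τ a => by
    have : ((τ : S →+* S).comp e) = e := Subsingleton.elim _ _
    exact DFunLike.congr_fun this a
  have he_surj : ∀ z : S, z ^ p = z → ∃ a, e a = z := fun z hz => by
    have h1 := (Subfield.mem_bot_iff_pow_eq_self S p).2 hz
    have h2 : (⊥ : Subfield S) ≤ e.fieldRange := bot_le
    exact h2 h1
  obtain ⟨β, hβ, hβ1⟩ := exists_fixed_trace_eq_one hX ht htp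
  -- The trace of `β ^ p - β` is `1 ^ p - 1 = 0`. With this `γ`, the element `t y` is `y + β` up to
  -- a constant in `𝔽_p`.
  obtain ⟨γ, hγ, htγ⟩ := exists_sub_eq_of_trace_eq_zero (δ := β ^ p - β) htp hβ hβ1
    (fun h hh => by rw [map_sub, map_pow, hβ h hh]) (by
      simp only [map_sub, map_pow, Finset.sum_sub_distrib]
      rw [← sum_pow_char, hβ1, one_pow, sub_self])
  obtain ⟨y, hy⟩ := exists_artinSchreier_root (p := p) γ
  have hroot : ∀ (τ : Gal(S/F)) (b : S), τ γ = γ + (b ^ p - b) → ∃ a, τ y = y + b + e a := by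
    intro τ b hτ
    obtain ⟨a, ha⟩ := he_surj (τ y - y - b) (by
      rw [sub_pow_char, sub_pow_char]
      have h1 := congrArg τ hy
      rw [map_sub, map_pow, hτ, ← hy] at h1
      linear_combination h1)
    exact ⟨a, by rw [ha]; ring⟩
  have hu : ∀ τ : Gal(S/F), ∃ a, τ ∈ X → τ y = y + e a := fun τ => by
    by_cases hτ : τ ∈ X
    · obtain ⟨a, ha⟩ := hroot τ 0 (by rw [hγ τ hτ, zero_pow hp.ne_zero]; ring)
      exact ⟨a, fun _ => by rw [ha]; ring⟩
    · exact ⟨0, fun h => absurd h hτ⟩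
  choose u hu using hu
  have hchar : IsCharacter p X u := by
    refine IsCharacter.of_open (Z := X ∩ (MulAction.stabilizer Gal(S/F) y : Set Gal(S/F))) ?_
      (hX.inter (stabilizer_isOpen_of_isIntegral y)) ⟨X.one_mem, one_mem _⟩ ?_
    · intro g hg h hh
      apply he_inj
      have h1 := hu _ (X.mul_mem hg hh)
      rw [AlgEquiv.mul_apply, hu h hh, map_add, hu g hg, he_fix] at h1
      rw [map_add]
      linear_combination -h1
    · rintro h ⟨h1, h2⟩
      refine ⟨h1, he_inj ?_⟩
      have h3 : h y = y := h2
      rw [hu h h1] at h3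
      rw [map_zero]
      linear_combination h3
  obtain ⟨c, hc⟩ := hroot t β htγ
  refine hchar.hasInvariantNonNorm htp (fun h hh => ?_) fun h0 => ?_
  · have h1 : t⁻¹ * h * t ∈ X := by simpa using Subgroup.Normal.conj_mem ‹_› h hh t⁻¹
    have h2 := congrArg t (hu _ h1)
    rw [← AlgEquiv.mul_apply, show t * (t⁻¹ * h * t) = h * t by group, AlgEquiv.mul_apply, hc,
      map_add, map_add, map_add, hu h hh, hβ h hh, he_fix, he_fix, hc] at h2
    apply he_inj
    linear_combination -h2
  -- At `i = p` the trace of `β` contributes `1` and the constant drops out: `(t ^ p) y = y + 1`, so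
  -- the character is nonzero at `t ^ p`.
  · have h1 : ∀ i : ℕ, (t ^ i) y = y + ∑ l ∈ Finset.range i, (t ^ l) β + i * e c := by
      intro i
      induction i with
      | zero => simp
      | succ i ih =>
        rw [pow_succ, AlgEquiv.mul_apply, hc, map_add, map_add, ih, he_fix,
          Finset.sum_range_succ]
        push_cast
        ring
    have h2 := h1 p
    rw [hu _ htp, h0, hβ1] at h2
    simp at h2

end ArtinSchreier

/-! ### Kummer characters -/

section Kummer

variable {F S : Type*} [Field F] [Field S] [Algebra F S] {p : ℕ} [Fact p.Prime]
  {ζ : S} (hζ : IsPrimitiveRoot ζ p)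

/-- The additive character of `ZMod p` attached to a root of unity `ζ` of order `p`. -/
noncomputable def IsPrimitiveRoot.zmodAddChar : AddChar (ZMod p) S :=
  AddChar.zmodChar p hζ.pow_eq_one

theorem IsPrimitiveRoot.zmodAddChar_apply (a : ZMod p) : hζ.zmodAddChar a = ζ ^ a.val := rfl

theorem IsPrimitiveRoot.zmodAddChar_ne_zero (a : ZMod p) : hζ.zmodAddChar a ≠ 0 := by
  rw [hζ.zmodAddChar_apply]
  exact pow_ne_zero _ (hζ.ne_zero (Fact.out : p.Prime).ne_zero)

theorem IsPrimitiveRoot.zmodAddChar_injective : Function.Injective hζ.zmodAddChar := by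
  intro a b h
  exact ZMod.val_injective p (hζ.pow_inj a.val_lt b.val_lt h)

theorem IsPrimitiveRoot.exists_zmodAddChar_eq {z : S} (hz : z ^ p = 1) :
    ∃ a, hζ.zmodAddChar a = z := by
  obtain ⟨i, hi, h⟩ := hζ.eq_pow_of_pow_eq_one hz
  refine ⟨(i : ZMod p), ?_⟩
  rw [hζ.zmodAddChar_apply, ZMod.val_natCast_of_lt hi, h]

theorem IsPrimitiveRoot.zmodAddChar_pow (a : ZMod p) (n : ℕ) :
    hζ.zmodAddChar a ^ n = hζ.zmodAddChar (n * a) := by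
  rw [← nsmul_eq_mul, AddChar.map_nsmul_eq_pow]

theorem IsPrimitiveRoot.zmodAddChar_pow_prime (a : ZMod p) : hζ.zmodAddChar a ^ p = 1 := by
  simp [hζ.zmodAddChar_pow]

theorem IsPrimitiveRoot.galois_zmodAddChar {τ : Gal(S/F)} {k : ℕ} (hτ : τ ζ = ζ ^ k)
    (a : ZMod p) : τ (hζ.zmodAddChar a) = hζ.zmodAddChar a ^ k := by
  rw [hζ.zmodAddChar_apply, map_pow, hτ, ← pow_mul, ← pow_mul, mul_comm]

theorem IsPrimitiveRoot.galois_zmodAddChar_of_fixed {τ : Gal(S/F)} (hτ : τ ζ = ζ)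
    (a : ZMod p) : τ (hζ.zmodAddChar a) = hζ.zmodAddChar a := by
  rw [hζ.zmodAddChar_apply, map_pow, hτ]

theorem IsPrimitiveRoot.exists_eq_zmodAddChar_mul {x y : S} (hy : y ≠ 0) (h : x ^ p = y ^ p) :
    ∃ a, x = hζ.zmodAddChar a * y := by
  obtain ⟨a, ha⟩ := hζ.exists_zmodAddChar_eq (z := x / y) (by
    rw [div_pow, h, div_self (pow_ne_zero _ hy)])
  exact ⟨a, by rw [ha, div_mul_cancel₀ _ hy]⟩

/-- The Kummer character of a `p`-th root `y` of an element fixed by `Y`. -/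
theorem IsPrimitiveRoot.exists_kummer_character [IsGalois F S] {Y : Subgroup Gal(S/F)}
    (hY : IsOpen (Y : Set Gal(S/F))) (hYζ : ∀ h ∈ Y, h ζ = ζ) {y : S} (hy : y ≠ 0)
    (hyp : ∀ h ∈ Y, h (y ^ p) = y ^ p) :
    ∃ u : Gal(S/F) → ZMod p, IsCharacter p Y u ∧ ∀ h ∈ Y, h y = hζ.zmodAddChar (u h) * y := by
  have hu : ∀ τ : Gal(S/F), ∃ a, τ ∈ Y → τ y = hζ.zmodAddChar a * y := fun τ => by
    by_cases hτ : τ ∈ Y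
    · obtain ⟨a, ha⟩ := hζ.exists_eq_zmodAddChar_mul hy ((map_pow τ y p).symm.trans (hyp τ hτ))
      exact ⟨a, fun _ => ha⟩
    · exact ⟨0, fun h => absurd h hτ⟩
  choose u hu using hu
  refine ⟨u, ?_, hu⟩
  refine IsCharacter.of_open (Z := Y ∩ (MulAction.stabilizer Gal(S/F) y : Set Gal(S/F))) ?_
      (hY.inter (stabilizer_isOpen_of_isIntegral y)) ⟨Y.one_mem, one_mem _⟩ ?_
  · intro g hg h hh
    apply hζ.zmodAddChar_injective
    have h1 := hu _ (Y.mul_mem hg hh)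
    rw [AlgEquiv.mul_apply, hu h hh, map_mul, hu g hg,
      hζ.galois_zmodAddChar_of_fixed (hYζ g hg)] at h1
    rw [AddChar.map_add_eq_mul]
    apply mul_right_cancel₀ hy
    linear_combination -h1
  · rintro h ⟨h1, h2⟩
    refine ⟨h1, hζ.zmodAddChar_injective ?_⟩
    have h3 : h y = y := h2
    rw [hu h h1] at h3
    rw [AddChar.map_zero_eq_one]
    apply mul_right_cancel₀ hy
    rw [h3, one_mul]

/-- Every character of `Y` is a Kummer character. -/
theorem IsPrimitiveRoot.exists_kummer_generator [IsGalois F S] {Y : Subgroup Gal(S/F)}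
    (hYζ : ∀ h ∈ Y, h ζ = ζ) {v : Gal(S/F) → ZMod p} (hv : IsCharacter p Y v) :
    ∃ y : S, y ≠ 0 ∧ ∀ h ∈ Y, h y = hζ.zmodAddChar (v h) * y := by
  have hp := (Fact.out : p.Prime)
  by_cases h0 : ∀ h ∈ Y, v h = 0
  · exact ⟨1, one_ne_zero, fun h hh => by simp [h0 h hh]⟩
  push Not at h0
  obtain ⟨g₀, hg₀, hne⟩ := h0
  obtain ⟨g, hg, hg1⟩ : ∃ g ∈ Y, v g = 1 := by
    refine ⟨g₀ ^ ((v g₀)⁻¹).val, Y.pow_mem hg₀ _, ?_⟩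
    rw [hv.map_pow hg₀, ZMod.natCast_zmod_val, inv_mul_cancel₀ hne]
  let Z : Subgroup Gal(S/F) :=
    { carrier := {h | h ∈ Y ∧ v h = 0}
      mul_mem' := fun {a b} ha hb =>
        ⟨Y.mul_mem ha.1 hb.1, by rw [hv.1 _ ha.1 _ hb.1, ha.2, hb.2, add_zero]⟩
      one_mem' := ⟨Y.one_mem, hv.map_one⟩
      inv_mem' := fun {a} ha => ⟨Y.inv_mem ha.1, by rw [hv.map_inv ha.1, ha.2, neg_zero]⟩ }
  have hgp : g ^ p ∈ Z := ⟨Y.pow_mem hg _, by rw [hv.map_pow hg]; simp⟩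
  have hgZ : g ∉ Z := fun h => by
    have h2 : v g = 0 := h.2
    rw [hg1] at h2
    exact one_ne_zero h2
  -- A Lagrange resolvent over `Z`, the kernel of `v`: the weights `ζ ^ (-i)` make the sum an
  -- eigenvector of `g` with eigenvalue `ζ`, where `v g = 1`.
  obtain ⟨x, hx, hxne⟩ := exists_fixed_sum_ne_zero (Y := Z) hv.2 hp.pos
    (fun i hi1 hi2 => pow_notMem_of_prime hp hgZ hgp hi1 hi2)
    (fun i => hζ.zmodAddChar (-i)) (by simp)
  set y := ∑ i ∈ Finset.range p, hζ.zmodAddChar (-(i : ZMod p)) * (g ^ i) x with hy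
  have hgy : g y = hζ.zmodAddChar 1 * y := by
    rw [hy, map_sum, Finset.mul_sum]
    simp only [map_mul, galois_pow_succ_apply, hζ.galois_zmodAddChar_of_fixed (hYζ g hg),
      ← mul_assoc, ← AddChar.map_add_eq_mul]
    have h1 := Finset.sum_range_succ
      (fun i : ℕ => hζ.zmodAddChar (1 + -(i : ZMod p)) * (g ^ i) x) p
    have h2 := Finset.sum_range_succ'
      (fun i : ℕ => hζ.zmodAddChar (1 + -(i : ZMod p)) * (g ^ i) x) p
    simp only [hx _ hgp, CharP.cast_eq_zero, Nat.cast_zero, pow_zero, AlgEquiv.one_apply] at h1 h2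
    rw [add_right_cancel (h1.symm.trans h2)]
    refine Finset.sum_congr rfl fun i _ => ?_
    congr 2
    push_cast
    ring
  have hZy : ∀ h ∈ Z, h y = y := by
    intro h hh
    rw [hy, map_sum]
    refine Finset.sum_congr rfl fun i _ => ?_
    rw [map_mul, hζ.galois_zmodAddChar_of_fixed (hYζ h hh.1)]
    congr 1
    have hgi := Y.pow_mem hg i
    have h1 : (g ^ i)⁻¹ * h * g ^ i ∈ Z :=
      ⟨Y.mul_mem (Y.mul_mem (Y.inv_mem hgi) hh.1) hgi, by rw [hv.map_conj hgi hh.1, hh.2]⟩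
    have h2 := congrArg (g ^ i) (hx _ h1)
    rwa [← AlgEquiv.mul_apply, show g ^ i * ((g ^ i)⁻¹ * h * g ^ i) = h * g ^ i by group,
      AlgEquiv.mul_apply] at h2
  have hgiy : ∀ i : ℕ, (g ^ i) y = hζ.zmodAddChar i * y := by
    intro i
    induction i with
    | zero => simp
    | succ i ih =>
      rw [← galois_pow_succ_apply, ih, map_mul, hgy,
        hζ.galois_zmodAddChar_of_fixed (hYζ g hg), ← mul_assoc, ← AddChar.map_add_eq_mul]
      push_cast
      rfl
  refine ⟨y, hxne, fun h hh => ?_⟩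
  have hgi := Y.pow_mem hg (v h).val
  have h1 : (g ^ (v h).val)⁻¹ * h ∈ Z :=
    ⟨Y.mul_mem (Y.inv_mem hgi) hh, by
      rw [hv.1 _ (Y.inv_mem hgi) _ hh, hv.map_inv hgi, hv.map_pow hg, ZMod.natCast_zmod_val, hg1]
      ring⟩
  have h2 : h = g ^ (v h).val * ((g ^ (v h).val)⁻¹ * h) := by group
  conv_lhs => rw [h2, AlgEquiv.mul_apply, hZy _ h1, hgiy, ZMod.natCast_zmod_val]

/-- The elements `y` and `t y` differ by a factor fixed by `Y`, so they have the same Kummer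
character; as `t` fixes `ζ`, that of `t y` is the conjugate by `t` of that of `y`. -/
theorem IsPrimitiveRoot.kummer_character_invariant {Y : Subgroup Gal(S/F)} [Y.Normal]
    {t : Gal(S/F)} (htζ : t ζ = ζ) {y κ : S} (hy : y ≠ 0)
    (hκY : ∀ h ∈ Y, h κ = κ) (hty : t y = κ * y) {u : Gal(S/F) → ZMod p}
    (hu : ∀ h ∈ Y, h y = hζ.zmodAddChar (u h) * y) :
    ∀ h ∈ Y, u (t⁻¹ * h * t) = u h := by
  intro h hh
  have h1 : t⁻¹ * h * t ∈ Y := by simpa using Subgroup.Normal.conj_mem ‹_› h hh t⁻¹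
  have h2 := congrArg t (hu _ h1)
  rw [← AlgEquiv.mul_apply, show t * (t⁻¹ * h * t) = h * t by group, AlgEquiv.mul_apply,
    map_mul, hζ.galois_zmodAddChar_of_fixed htζ, hty, map_mul, hκY h hh, hu h hh] at h2
  have hκy : κ * y ≠ 0 := by rw [← hty]; simpa using hy
  apply hζ.zmodAddChar_injective
  apply mul_right_cancel₀ hκy
  linear_combination -h2

end Kummer

/-! ### Norms along `t` of elements and of Kummer characters -/

section Kummer

variable {F S : Type*} [Field F] [Field S] [Algebra F S] {p : ℕ} [Fact p.Prime]
  {ζ : S}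

theorem IsPrimitiveRoot.zmodAddChar_sum (hζ : IsPrimitiveRoot ζ p) {ι : Type*} (s : Finset ι)
    (f : ι → ZMod p) : hζ.zmodAddChar (∑ i ∈ s, f i) = ∏ i ∈ s, hζ.zmodAddChar (f i) := by
  classical
  induction s using Finset.induction_on with
  | empty => simp
  | insert a s ha ih => rw [Finset.sum_insert ha, Finset.prod_insert ha, AddChar.map_add_eq_mul, ih]

/-- Iterating `t y = ζ ^ j * κ * y`. -/
theorem IsPrimitiveRoot.pow_apply_eq (hζ : IsPrimitiveRoot ζ p) {t : Gal(S/F)} (htζ : t ζ = ζ) {y κ : S} {j : ZMod p}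
    (hty : t y = hζ.zmodAddChar j * κ * y) (i : ℕ) :
    (t ^ i) y = hζ.zmodAddChar (i * j) * (∏ l ∈ Finset.range i, (t ^ l) κ) * y := by
  induction i with
  | zero => simp
  | succ i ih =>
    rw [pow_succ, AlgEquiv.mul_apply, hty, map_mul, map_mul, ih,
      galois_pow_apply_of_apply (hζ.galois_zmodAddChar_of_fixed htζ j), Finset.prod_range_succ]
    push_cast
    rw [add_mul, one_mul, AddChar.map_add_eq_mul]
    ring

/-- If some `β` fixed by `X ⊓ χ.ker` has a nontrivial `p`-th root of unity as norm along `t`, then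
Hilbert 90, Kummer theory and corestriction to `X` give an invariant character which is not a
norm. -/
theorem IsPrimitiveRoot.hasInvariantNonNorm_of_prod_ne_one (hζ : IsPrimitiveRoot ζ p) [IsGalois F S] [IsSepClosed S]
    [NeZero (p : S)] {M : Type*} [CommGroup M] [Fintype M] (hM : (Fintype.card M).Coprime p)
    (χ : Gal(S/F) →* M) {X : Subgroup Gal(S/F)} [X.Normal]
    (hY : IsOpen ((X ⊓ χ.ker : Subgroup Gal(S/F)) : Set Gal(S/F)))
    (hYζ : ∀ h ∈ X ⊓ χ.ker, h ζ = ζ) {t : Gal(S/F)} (htX : t ∉ X) (htp : t ^ p ∈ X)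
    (htχ : χ t = 1) (htζ : t ζ = ζ) {β : S} (hβ : ∀ h ∈ X ⊓ χ.ker, h β = β)
    (hN : ∏ i ∈ Finset.range p, (t ^ i) β ≠ 1) (hNp : (∏ i ∈ Finset.range p, (t ^ i) β) ^ p = 1) :
    HasInvariantNonNorm p X t := by
  have hp := (Fact.out : p.Prime)
  have htpY : t ^ p ∈ X ⊓ χ.ker := ⟨htp, by simp [htχ]⟩
  have hβ0 : β ≠ 0 := by
    rintro rfl
    simp [hp.ne_zero] at hNp
  -- The norm of `β` is a `p`-th root of unity, so `β ^ p` has norm `1`.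
  obtain ⟨γ, hγ0, hγ, htγ⟩ := exists_mul_apply_eq_of_prod_eq_one (b := β ^ p) hY hp.pos htpY
    (fun i h1 h2 h3 => pow_notMem_of_prime hp htX htp h1 h2 h3.1)
    (fun h hh => by rw [map_pow, hβ h hh]) (by
      rw [← hNp, ← Finset.prod_pow]
      simp only [map_pow])
  obtain ⟨y, hyγ⟩ := IsSepClosed.exists_pow_nat_eq γ p
  have hy0 : y ≠ 0 := by
    rintro rfl
    rw [zero_pow hp.ne_zero] at hyγ
    exact hγ0 hyγ.symm
  obtain ⟨u, hu, huy⟩ := hζ.exists_kummer_character hY hYζ hy0 (by rwa [hyγ])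
  obtain ⟨j, hj⟩ := hζ.exists_eq_zmodAddChar_mul (x := t y) (y := β⁻¹ * y)
    (mul_ne_zero (inv_ne_zero hβ0) hy0) (by
      rw [← map_pow, hyγ, mul_pow, hyγ, ← htγ, ← mul_assoc, ← mul_pow, inv_mul_cancel₀ hβ0,
        one_pow, one_mul, htγ])
  rw [← mul_assoc] at hj
  have huinv := hζ.kummer_character_invariant htζ hy0 (κ := hζ.zmodAddChar j * β⁻¹)
    (fun h hh => by
      rw [map_mul, hζ.galois_zmodAddChar_of_fixed (hYζ h hh), map_inv₀, hβ h hh]) hj huy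
  -- Iterating `t y = ζ ^ j * β⁻¹ * y` yields `(t ^ p) y = N(β)⁻¹ * y`, since `ζ ^ (p * j) = 1`, and
  -- `N(β) ≠ 1`.
  have hut : u (t ^ p) ≠ 0 := by
    intro h0
    have h1 := huy _ htpY
    rw [hζ.pow_apply_eq htζ hj, h0] at h1
    have h2 := mul_right_cancel₀ hy0 h1
    simp only [CharP.cast_eq_zero, zero_mul, AddChar.map_zero_eq_one, one_mul, map_inv₀,
      Finset.prod_inv_distrib] at h2
    exact hN (inv_eq_one.1 h2)
  obtain ⟨U, d, hd, hU, hUinv, hUt, -⟩ := IsCharacter.exists_transfer hM χ X htχ htp hu huinv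
  refine hU.hasInvariantNonNorm htp hUinv ?_
  rw [hUt]
  refine mul_ne_zero (fun h => ?_) hut
  rw [ZMod.natCast_eq_zero_iff] at h
  exact hp.one_lt.ne' (Nat.Coprime.eq_one_of_dvd hd.symm h)

/-- If all invariant characters of `X` are norms, then a suitable power of `f` is a norm up to
sign. -/
theorem IsPrimitiveRoot.exists_prod_eq_of_not_hasInvariantNonNorm (hζ : IsPrimitiveRoot ζ p) [IsGalois F S] [IsSepClosed S]
    [NeZero (p : S)] {M : Type*} [CommGroup M] [Fintype M] (hM : (Fintype.card M).Coprime p)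
    (χ : Gal(S/F) →* M) {X : Subgroup Gal(S/F)} [X.Normal]
    (hY : IsOpen ((X ⊓ χ.ker : Subgroup Gal(S/F)) : Set Gal(S/F)))
    (hYζ : ∀ h ∈ X ⊓ χ.ker, h ζ = ζ) {t : Gal(S/F)} (htp : t ^ p ∈ X)
    (htχ : χ t = 1) (htζ : t ζ = ζ) (hnon : ¬ HasInvariantNonNorm p X t) {w : S} (hw : w ≠ 0)
    (hwY : ∀ h ∈ X ⊓ χ.ker, h (w ^ p) = w ^ p) (htw : t (w ^ p) = w ^ p)
    (hconj : ∀ u : Gal(S/F) → ZMod p, (∀ h ∈ X ⊓ χ.ker, h w = hζ.zmodAddChar (u h) * w) →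
      ∀ h ∈ X ⊓ χ.ker, ∀ c ∈ X, u (c⁻¹ * h * c) = u h) :
    ∃ (d : ℕ) (z η : S), d.Coprime p ∧ z ≠ 0 ∧ (∀ h ∈ X ⊓ χ.ker, h z = z) ∧ η ^ 2 = 1 ∧
      η ^ p = 1 ∧ ∏ i ∈ Finset.range p, (t ^ i) z = η * (w ^ p) ^ d := by
  have hp := (Fact.out : p.Prime)
  have htpY : t ^ p ∈ X ⊓ χ.ker := ⟨htp, by simp [htχ]⟩
  obtain ⟨u, hu, huw⟩ := hζ.exists_kummer_character hY hYζ hw hwY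
  obtain ⟨j₀, hj₀⟩ := hζ.exists_eq_zmodAddChar_mul (x := t w) hw (by rw [← map_pow, htw])
  have huinv := hζ.kummer_character_invariant htζ hw (κ := hζ.zmodAddChar j₀)
    (fun h hh => hζ.galois_zmodAddChar_of_fixed (hYζ h hh) _) hj₀ huw
  obtain ⟨U, d, hd, hU, hUinv, -, hUd⟩ := IsCharacter.exists_transfer hM χ X htχ htp hu huinv
  obtain ⟨v, hv, hUv⟩ : ∃ v, IsCharacter p X v ∧
      ∀ h ∈ X, U h = ∑ j ∈ Finset.range p, v ((t ^ j)⁻¹ * h * t ^ j) := by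
    by_contra! hcon
    exact hnon ⟨U, hU, hUinv, fun v hv h => by
      obtain ⟨x, hx, hne⟩ := hcon v hv
      exact hne (h x hx)⟩
  -- The relation "`U` is the norm of `v`" is turned into one between elements: the norm `P` of a
  -- Kummer generator of `v` has character `U` on `X ⊓ χ.ker`.
  obtain ⟨y, hy, hvy⟩ := hζ.exists_kummer_generator hYζ (hv.mono inf_le_left hY)
  set P := ∏ i ∈ Finset.range p, (t ^ i) y with hP
  have hP0 : P ≠ 0 := Finset.prod_ne_zero_iff.2 fun i _ => (map_ne_zero _).2 hy
  have hPh : ∀ h ∈ X ⊓ χ.ker, h P = hζ.zmodAddChar (U h) * P := by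
    intro h hh
    rw [hUv h hh.1, hζ.zmodAddChar_sum, hP, map_prod, ← Finset.prod_mul_distrib]
    refine Finset.prod_congr rfl fun i _ => ?_
    have h1 : (t ^ i)⁻¹ * h * t ^ i ∈ X ⊓ χ.ker := by
      simpa using Subgroup.Normal.conj_mem inferInstance h hh (t ^ i)⁻¹
    have h2 := congrArg (t ^ i) (hvy _ h1)
    rwa [← AlgEquiv.mul_apply, show t ^ i * ((t ^ i)⁻¹ * h * t ^ i) = h * t ^ i by group,
      AlgEquiv.mul_apply, map_mul,
      galois_pow_apply_of_apply (hζ.galois_zmodAddChar_of_fixed htζ _)] at h2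
  -- Numerator and denominator have the same Kummer character on `X ⊓ χ.ker`: by `hconj`, the
  -- corestriction restricts there to `d * u`.
  set r := w ^ d / P with hr
  have hr0 : r ≠ 0 := div_ne_zero (pow_ne_zero _ hw) hP0
  have hrY : ∀ h ∈ X ⊓ χ.ker, h r = r := by
    intro h hh
    rw [hr, map_div₀, map_pow, huw h hh, hPh h hh, hUd h hh (hconj u huw h hh), mul_pow,
      hζ.zmodAddChar_pow, mul_div_mul_left _ _ (hζ.zmodAddChar_ne_zero _)]
  have hyp : ∀ h ∈ X ⊓ χ.ker, h (y ^ p) = y ^ p := fun h hh => by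
    rw [map_pow, hvy h hh, mul_pow, hζ.zmodAddChar_pow_prime, one_mul]
  have hPp : P ^ p = ∏ i ∈ Finset.range p, (t ^ i) (y ^ p) := by
    rw [hP, ← Finset.prod_pow]
    simp only [map_pow]
  have hrp : P ^ p * r ^ p = (w ^ p) ^ d := by
    rw [← mul_pow, hr, mul_div_cancel₀ _ hP0, ← pow_mul, ← pow_mul, mul_comm]
  have htP : t (P ^ p) = P ^ p := by
    rw [hPp]
    exact apply_prod_pow_apply (hyp _ htpY)
  -- Both `P ^ p` and `w ^ p` are fixed by `t`, hence so is `r ^ p`, and `t r = ζ ^ j * r`.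
  obtain ⟨j, hj⟩ := hζ.exists_eq_zmodAddChar_mul (x := t r) hr0 (by
    rw [← map_pow]
    apply mul_left_cancel₀ (pow_ne_zero p hP0)
    rw [hrp]
    conv_lhs => rw [← htP]
    rw [← map_mul, hrp, map_pow, htw])
  rw [← mul_one (hζ.zmodAddChar j)] at hj
  -- The norm of `y ^ p` is `P ^ p`, and that of `r` is `r ^ p` times `ζ` to the power `j * (0 + 1 +
  -- ... + (p - 1))`. This root of unity is the sign `η`.
  refine ⟨d, y ^ p * r, hζ.zmodAddChar (∑ i ∈ Finset.range p, (i : ZMod p) * j), hd,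
    mul_ne_zero (pow_ne_zero _ hy) hr0, fun h hh => ?_, ?_, hζ.zmodAddChar_pow_prime _, ?_⟩
  · rw [map_mul, hrY h hh, hyp h hh]
  · rw [hζ.zmodAddChar_pow, ← Finset.sum_mul, ← mul_assoc, ← Nat.cast_sum, ← Nat.cast_mul,
      mul_comm 2, Finset.sum_range_id_mul_two]
    simp
  · simp only [map_mul, Finset.prod_mul_distrib]
    rw [← hPp, ← hrp, hζ.zmodAddChar_sum]
    have : ∏ i ∈ Finset.range p, (t ^ i) r =
        (∏ i ∈ Finset.range p, hζ.zmodAddChar ((i : ZMod p) * j)) * r ^ p := by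
      have hcard : r ^ p = ∏ _i ∈ Finset.range p, r := by simp
      rw [hcard, ← Finset.prod_mul_distrib]
      refine Finset.prod_congr rfl fun i _ => ?_
      rw [hζ.pow_apply_eq htζ hj]
      simp
    rw [this]
    ring

end Kummer

/-! ### Invariant characters that are not norms -/

section Existence

variable {F S : Type*} [Field F] [Field S] [Algebra F S] [IsGalois F S] [IsSepClosed S]
  {p : ℕ} [Fact p.Prime]

/-- In characteristic not `p` and for odd `p`, some `t` has an invariant character which is not a
norm. -/
theorem exists_hasInvariantNonNorm_of_odd [NeZero (p : S)] (hp2 : p ≠ 2)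
    {X : Subgroup Gal(S/F)} [X.Normal] (hX : IsOpen (X : Set Gal(S/F))) {t₁ : Gal(S/F)}
    (ht₁ : t₁ ∉ X) (ht₁p : t₁ ^ p ∈ X) : ∃ t, t ∉ X ∧ t ^ p ∈ X ∧ HasInvariantNonNorm p X t := by
  have hp := (Fact.out : p.Prime)
  obtain ⟨ζ, hζ⟩ := HasEnoughRootsOfUnity.prim (M := S) (n := p)
  let χ : Gal(S/F) →* (ZMod p)ˣ := (modularCyclotomicCharacter S hζ.card_rootsOfUnity).comp
    (MulSemiringAction.toRingAut Gal(S/F) S)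
  have hχ : ∀ τ : Gal(S/F), τ ζ = ζ ^ (χ τ : ZMod p).val := fun τ => by
    have hζ0 := hζ.isUnit hp.ne_zero
    have := modularCyclotomicCharacter.spec S hζ.card_rootsOfUnity
      (MulSemiringAction.toRingAut Gal(S/F) S τ) (t := hζ0.unit)
      (by rw [mem_rootsOfUnity]; ext; simpa using hζ.pow_eq_one)
    exact this
  have hχ1 : ∀ τ : Gal(S/F), χ τ = 1 ↔ τ ζ = ζ := fun τ => by
    have : Fact (1 < p) := ⟨hp.one_lt⟩
    rw [hχ τ]
    constructor
    · intro h
      rw [h, Units.val_one, ZMod.val_one, pow_one]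
    · intro h
      have h2 := hζ.pow_inj (ZMod.val_lt _) hp.one_lt (h.trans (pow_one ζ).symm)
      rw [← ZMod.val_one p] at h2
      exact Units.ext (ZMod.val_injective p h2)
  have hM : (Fintype.card (ZMod p)ˣ).Coprime p := by
    rw [ZMod.card_units]
    exact (Nat.coprime_self_sub_left hp.one_le).2 (Nat.coprime_one_left p)
  have hY : IsOpen ((X ⊓ χ.ker : Subgroup Gal(S/F)) : Set Gal(S/F)) := by
    rw [Subgroup.coe_inf]
    refine hX.inter ?_
    convert stabilizer_isOpen_of_isIntegral (K := F) ζ using 1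
    ext τ
    exact hχ1 τ
  have hYζ : ∀ h ∈ X ⊓ χ.ker, h ζ = ζ := fun h hh => (hχ1 h).1 hh.2
  -- The exponent kills `(ZMod p)ˣ`, so `t` fixes `ζ`; being prime to `p`, it keeps `t` outside `X`.
  set t := t₁ ^ (p - 1) with ht
  have htX : t ∉ X := pow_notMem_of_prime hp ht₁ ht₁p (Nat.sub_pos_of_lt hp.one_lt)
    (Nat.sub_lt hp.pos one_pos)
  have htp : t ^ p ∈ X := by
    rw [ht, ← pow_mul, mul_comm, pow_mul]
    exact pow_mem ht₁p _
  have htχ : χ t = 1 := by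
    rw [ht, map_pow, ZMod.units_pow_card_sub_one_eq_one]
  have htζ := (hχ1 t).1 htχ
  refine ⟨t, htX, htp, ?_⟩
  by_contra hnon
  have hζ0 : ζ ≠ 0 := hζ.ne_zero hp.ne_zero
  obtain ⟨w, hw⟩ := IsSepClosed.exists_pow_nat_eq ζ p
  have hw0 : w ≠ 0 := by
    rintro rfl
    rw [zero_pow hp.ne_zero] at hw
    exact hζ0 hw.symm
  obtain ⟨d, z, η, hd, hz0, hz, hη2, hηp, hN⟩ := hζ.exists_prod_eq_of_not_hasInvariantNonNorm hM χ
    hY hYζ htp htχ htζ hnon hw0 (by rwa [hw]) (by rwa [hw]) (by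
      intro u hu h hh c hc
      have h1 : c⁻¹ * h * c ∈ X ⊓ χ.ker := by
        simpa using Subgroup.Normal.conj_mem inferInstance h hh c⁻¹
      have h2 := congrArg c (hu _ h1)
      rw [← AlgEquiv.mul_apply, show c * (c⁻¹ * h * c) = h * c by group, AlgEquiv.mul_apply,
        map_mul] at h2
      -- Since `w ^ p = ζ`, the automorphism `c` raises `w` to the power `χ c`, up to a root of
      -- unity. It raises `ζ` to the same power, so the two twists of the Kummer character cancel.
      obtain ⟨a, ha⟩ := hζ.exists_eq_zmodAddChar_mul (x := c w)
        (y := w ^ (χ c : ZMod p).val) (pow_ne_zero _ hw0) (by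
          rw [← map_pow, hw, hχ c, ← pow_mul, mul_comm, pow_mul, hw])
      apply hζ.zmodAddChar_injective
      apply c.injective
      have hcw : c w ≠ 0 := by simpa using hw0
      apply mul_right_cancel₀ hcw
      rw [← h2, hζ.galois_zmodAddChar (hχ c), ha, map_mul,
        hζ.galois_zmodAddChar_of_fixed (hYζ h hh), map_pow, hu h hh]
      ring)
  have hη : η = 1 := by
    have hg := (Nat.Coprime.symm ((Nat.coprime_primes hp Nat.prime_two).2 hp2)).gcd_eq_one
    have := orderOf_dvd_of_pow_eq_one hη2
    have h2 := orderOf_dvd_of_pow_eq_one hηp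
    have h3 := Nat.dvd_gcd this h2
    rw [hg, Nat.dvd_one, orderOf_eq_one_iff] at h3
    exact h3
  rw [hη, one_mul, hw] at hN
  -- Now `z` itself has norm `ζ ^ d`, nontrivial because `d` is prime to `p`.
  refine hnon (hζ.hasInvariantNonNorm_of_prod_ne_one hM χ hY hYζ htX htp htχ htζ hz ?_ ?_)
  · rw [hN]
    intro h
    have := (hζ.dvd_of_pow_eq_one d h)
    exact hp.one_lt.ne' (Nat.Coprime.eq_one_of_dvd hd.symm this)
  · rw [hN, ← pow_mul, mul_comm, pow_mul, hζ.pow_eq_one, one_pow]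

/-- In characteristic not `2`, the square of an element of order `4` modulo `X` has an invariant
character which is not a norm. -/
theorem hasInvariantNonNorm_two [NeZero (2 : S)]
    {X : Subgroup Gal(S/F)} [X.Normal] (hX : IsOpen (X : Set Gal(S/F))) {t₀ : Gal(S/F)}
    (ht : t₀ ^ 2 ∉ X) (htp : (t₀ ^ 2) ^ 2 ∈ X) : HasInvariantNonNorm 2 X (t₀ ^ 2) := by
  have : NeZero ((2 : ℕ) : S) := ⟨by simpa using NeZero.ne (2 : S)⟩
  have hζ : IsPrimitiveRoot (-1 : S) 2 := by
    refine IsPrimitiveRoot.mk_of_lt _ two_pos (by norm_num) fun l h1 h2 h3 => ?_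
    obtain rfl : l = 1 := by omega
    rw [pow_one] at h3
    apply NeZero.ne (2 : S)
    linear_combination -h3
  -- The root of unity `-1` is already fixed, so no descent is needed.
  let χ : Gal(S/F) →* Unit := 1
  have hY : X ⊓ χ.ker = X := by simp [χ]
  have hfix : ∀ τ : Gal(S/F), τ (-1) = -1 := fun τ => by simp
  have h4 : ∀ i, 0 < i → i < 4 → t₀ ^ i ∉ X := by
    intro i h1 h2 h3
    interval_cases i
    · rw [pow_one] at h3
      exact ht (pow_mem h3 2)
    · exact ht h3
    · rw [← pow_mul] at htp
      have := mul_mem (inv_mem h3) htp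
      rw [show (t₀ ^ 3)⁻¹ * t₀ ^ (2 * 2) = t₀ by group] at this
      exact ht (pow_mem this 2)
  by_contra hnon
  -- The alternating sum over the four powers of `t₀` is a nonzero `α` with `t₀ α = -α`, hence fixed
  -- by `t₀ ^ 2`.
  obtain ⟨x, hx, hne⟩ := exists_fixed_sum_ne_zero hX (m := 4) (by norm_num) h4
    (fun i => (-1) ^ i) (by simp)
  set α := ∑ i ∈ Finset.range 4, (-1) ^ i * (t₀ ^ i) x with hα
  have hα' : α = x - t₀ x + (t₀ ^ 2) x - (t₀ ^ 3) x := by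
    rw [hα]
    simp [Finset.sum_range_succ]
    ring
  have hx4 : (t₀ ^ 4) x = x := hx _ (by rw [← pow_mul] at htp; exact htp)
  have ht₀α : t₀ α = -α := by
    rw [hα', map_sub, map_add, map_sub, galois_pow_succ_apply, galois_pow_succ_apply, hx4,
      show t₀ (t₀ x) = (t₀ ^ 2) x by rw [sq, AlgEquiv.mul_apply]]
    ring
  have htα : (t₀ ^ 2) α = α := by
    rw [sq, AlgEquiv.mul_apply, ht₀α, map_neg, ht₀α, neg_neg]
  have hαX : ∀ h ∈ X, h α = α := fun h hh => by
    have h1 := fun i : ℕ => fixed_apply_of_normal hx (t₀ ^ i) h hh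
    have h2 := fixed_apply_of_normal hx t₀ h hh
    rw [hα', map_sub, map_add, map_sub, hx h hh, h1, h1, h2]
  obtain ⟨w, hw⟩ := IsSepClosed.exists_pow_nat_eq α 2
  have hw0 : w ≠ 0 := by
    rintro rfl
    rw [zero_pow two_ne_zero] at hw
    exact hne hw.symm
  have hM : (Fintype.card Unit).Coprime 2 := by simp
  obtain ⟨d, z, η, hd, hz0, hz, hη2, -, hN⟩ :=
    hζ.exists_prod_eq_of_not_hasInvariantNonNorm hM χ
    (by rwa [hY]) (fun h _ => hfix h) htp rfl (hfix _) hnon hw0 (by rwa [hw, hY]) (by rwa [hw]) (by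
      rw [hY]
      intro u hu h hh c hc
      obtain ⟨u', hu', huw'⟩ := hζ.exists_kummer_character hX (fun h _ => hfix h) hw0
        (by rwa [hw])
      have huu : ∀ g ∈ X, u g = u' g := fun g hg =>
        hζ.zmodAddChar_injective (mul_right_cancel₀ hw0 ((hu g hg).symm.trans (huw' g hg)))
      rw [huu _ (mul_mem (mul_mem (inv_mem hc) hh) hc), huu h hh, hu'.map_conj hc hh])
  rw [hY] at hz
  rw [hw] at hN
  have hNz : ∏ i ∈ Finset.range 2, ((t₀ ^ 2) ^ i) (t₀ z) =
      t₀ (∏ i ∈ Finset.range 2, ((t₀ ^ 2) ^ i) z) := by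
    rw [map_prod]
    refine Finset.prod_congr rfl fun i _ => ?_
    rw [← AlgEquiv.mul_apply, ← AlgEquiv.mul_apply, ← pow_mul, ← pow_succ, ← pow_succ']
  have hη : t₀ η = η := by
    rcases sq_eq_one_iff.1 hη2 with h | h <;> simp [h]
  have hodd : Odd d := Nat.coprime_two_right.1 hd
  have hη0 : η ≠ 0 := by
    rintro rfl
    simp at hη2
  -- The norm of `z` is `η * α ^ d` with `d` odd. Since `t₀` commutes with the norm, fixes `η` and
  -- negates `α`, the quotient has norm `-1`; the unknown sign `η` cancels.
  have key : ∏ i ∈ Finset.range 2, ((t₀ ^ 2) ^ i) (t₀ z / z) = -1 := by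
    simp only [map_div₀]
    rw [Finset.prod_div_distrib, hNz, hN, map_mul, map_pow, hη, ht₀α, hodd.neg_pow]
    have : η * α ^ d ≠ 0 := mul_ne_zero hη0 (pow_ne_zero _ hne)
    field_simp
  refine hnon (hζ.hasInvariantNonNorm_of_prod_ne_one hM χ (by rwa [hY]) (fun h _ => hfix h) ht htp
    rfl (hfix _) (β := t₀ z / z) ?_ ?_ ?_)
  · rw [hY]
    intro h hh
    rw [map_div₀, hz h hh, fixed_apply_of_normal hz t₀ h hh]
  · rw [key]
    intro h
    apply NeZero.ne (2 : S)
    linear_combination -h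
  · rw [key]
    norm_num

/-- The character group of an open normal subgroup `X` is not cohomologically trivial. -/
theorem exists_hasInvariantNonNorm {X : Subgroup Gal(S/F)} [X.Normal]
    (hX : IsOpen (X : Set Gal(S/F))) {t₁ : Gal(S/F)} (ht₁ : t₁ ∉ X) (ht₁p : t₁ ^ p ∈ X)
    (h2 : p = 2 → ∃ t₀, t₁ = t₀ ^ 2) :
    ∃ t, t ∉ X ∧ t ^ p ∈ X ∧ HasInvariantNonNorm p X t := by
  by_cases hchar : (p : S) = 0
  · have : CharP S p := by
      obtain ⟨q, hq⟩ := CharP.exists S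
      have h1 := (CharP.cast_eq_zero_iff S q p).1 hchar
      rcases (Nat.dvd_prime (Fact.out : p.Prime)).1 h1 with h | h
      · subst h
        exact absurd (CharP.cast_eq_zero S 1) (by rw [Nat.cast_one]; exact one_ne_zero)
      · rwa [← h]
    exact ⟨t₁, ht₁, ht₁p, hasInvariantNonNorm_of_charP hX ht₁ ht₁p⟩
  · have : NeZero (p : S) := ⟨hchar⟩
    by_cases hp2 : p = 2
    · subst hp2
      obtain ⟨t₀, rfl⟩ := h2 rfl
      have : NeZero (2 : S) := ⟨by simpa using hchar⟩
      exact ⟨_, ht₁, ht₁p, hasInvariantNonNorm_two hX ht₁ ht₁p⟩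
    · exact exists_hasInvariantNonNorm_of_odd hp2 hX ht₁ ht₁p

end Existence

/-! ### The group algebra of a finite abelian `p`-group -/

section GroupAlgebra

variable {p : ℕ} [Fact p.Prime] {G : Type*} [CommGroup G] [Fintype G]

theorem MonoidAlgebra.coeff_of_mul_apply {R G : Type*} [Ring R] [Group G] (g h : G)
    (x : MonoidAlgebra R G) : (MonoidAlgebra.of R G g * x).coeff h = x.coeff (g⁻¹ * h) := by
  rw [MonoidAlgebra.of_apply, MonoidAlgebra.coeff_single_mul_apply, one_mul]

theorem MonoidAlgebra.eq_sum_single {R G : Type*} [Ring R] [Fintype G] (x : MonoidAlgebra R G) :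
    x = ∑ g, MonoidAlgebra.single g (x.coeff g) := by
  classical
  ext h
  simp [MonoidAlgebra.coeff_sum]

/-- Over a finite `p`-group, elements of augmentation zero in the group algebra over `ZMod p` are
nilpotent. -/
theorem MonoidAlgebra.isNilpotent_of_sum_coeff_eq_zero (hG : IsPGroup p G)
    {x : MonoidAlgebra (ZMod p) G} (hx : ∑ g, x.coeff g = 0) : IsNilpotent x := by
  obtain ⟨m, hm⟩ := IsPGroup.iff_card.1 hG
  have : CharP (MonoidAlgebra (ZMod p) G) p := charP_of_injective_algebraMap
    (FaithfulSMul.algebraMap_injective (ZMod p) (MonoidAlgebra (ZMod p) G)) p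
  -- With `p ^ m` the order of `G`, Frobenius turns `x` into the scalar given by its augmentation.
  refine ⟨p ^ m, ?_⟩
  rw [MonoidAlgebra.eq_sum_single x, sum_pow_char_pow]
  simp only [MonoidAlgebra.single_pow]
  have h1 : ∀ g : G, g ^ p ^ m = 1 := fun g => by
    rw [← hm]
    exact pow_card_eq_one'
  have h2 : ∀ a : ZMod p, a ^ p ^ m = a := fun a => ZMod.pow_card_pow a
  simp only [h1, h2]
  have h3 : ∀ s : Finset G, ∑ g ∈ s, (MonoidAlgebra.single 1 (x.coeff g) : MonoidAlgebra (ZMod p) G)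
      = MonoidAlgebra.single 1 (∑ g ∈ s, x.coeff g) := fun s =>
    (map_sum (MonoidAlgebra.singleAddHom (R := ZMod p) (1 : G)) _ _).symm
  rw [h3, hx, MonoidAlgebra.single_zero]

theorem MonoidAlgebra.sum_coeff_mul (x y : MonoidAlgebra (ZMod p) G) :
    ∑ g, (x * y).coeff g = (∑ g, x.coeff g) * ∑ g, y.coeff g := by
  induction x using MonoidAlgebra.induction_on with
  | of m =>
    classical
    simp only [MonoidAlgebra.coeff_of_mul_apply]
    have h1 : ∑ g, ((MonoidAlgebra.of (ZMod p) G) m).coeff g = 1 := by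
      simp [MonoidAlgebra.of_apply, Finsupp.single_apply]
    rw [h1, one_mul]
    exact Fintype.sum_equiv (Equiv.mulLeft m⁻¹) _ _ fun _ => rfl
  | add x y hx hy =>
    simp only [add_mul, MonoidAlgebra.coeff_add, Finsupp.add_apply, Finset.sum_add_distrib, hx, hy]
  | smul r x hx =>
    simp only [smul_mul_assoc, MonoidAlgebra.coeff_smul, Finsupp.smul_apply, smul_eq_mul,
      ← Finset.mul_sum, hx, mul_assoc]

/-- Nakayama's lemma for `(ZMod p)[G] ^ k`. -/
theorem addSubgroup_eq_top_of_sum_coeff_surjective (hG : IsPGroup p G) {k : ℕ}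
    (R : AddSubgroup (Fin k → MonoidAlgebra (ZMod p) G))
    (hR : ∀ x ∈ R, ∀ g, (fun i => MonoidAlgebra.of (ZMod p) G g * x i) ∈ R)
    (hsurj : ∀ y : Fin k → ZMod p, ∃ x ∈ R, ∀ i, ∑ g, (x i).coeff g = y i) : R = ⊤ := by
  classical
  let W : Submodule (MonoidAlgebra (ZMod p) G) (Fin k → MonoidAlgebra (ZMod p) G) :=
    { R with
      smul_mem' := fun a x hx => by
        induction a using MonoidAlgebra.induction_on with
        | of m => exact hR x hx m
        | add a b ha hb =>
          rw [add_smul]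
          exact R.add_mem ha hb
        | smul r a ha =>
          have : (r • a) • x = r.val • (a • x) := by
            rw [smul_assoc, ← ZMod.natCast_zmod_val r, Nat.cast_smul_eq_nsmul,
              ZMod.natCast_zmod_val]
          rw [this]
          exact R.nsmul_mem ha _ }
  let I : Ideal (MonoidAlgebra (ZMod p) G) :=
    { carrier := {x | ∑ g, x.coeff g = 0}
      add_mem' := fun {a b} ha hb => by
        simp only [Set.mem_ofPred_eq, MonoidAlgebra.coeff_add, Finsupp.add_apply,
          Finset.sum_add_distrib] at *
        rw [ha, hb, add_zero]
      zero_mem' := by simp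
      smul_mem' := fun a x hx => by
        simp only [Set.mem_ofPred_eq, smul_eq_mul, MonoidAlgebra.sum_coeff_mul] at *
        rw [hx, mul_zero] }
  have hI : I ≤ Ideal.jacobson ⊥ := by
    intro x hx
    rw [Ideal.mem_jacobson_bot]
    intro y
    have hnil : IsNilpotent x := MonoidAlgebra.isNilpotent_of_sum_coeff_eq_zero hG hx
    exact ((Commute.all x y).isNilpotent_mul_right hnil).isUnit_add_one
  have htop : (⊤ : Submodule (MonoidAlgebra (ZMod p) G) (Fin k → MonoidAlgebra (ZMod p) G)) ≤ W := by
    refine Submodule.le_of_le_smul_of_le_jacobson_bot (I := I) Module.Finite.fg_top hI ?_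
    intro x _
    obtain ⟨w, hw, hwx⟩ := hsurj fun i => ∑ g, (x i).coeff g
    rw [← add_sub_cancel w x]
    refine Submodule.add_mem_sup hw ?_
    rw [← Finset.univ_sum_single (x - w)]
    refine Submodule.sum_mem _ fun i _ => ?_
    have : (Pi.single i ((x - w) i) : Fin k → MonoidAlgebra (ZMod p) G) =
        (x - w) i • Pi.single i 1 := by
      rw [← Pi.single_smul, smul_eq_mul, mul_one]
    rw [this]
    refine Submodule.smul_mem_smul ?_ Submodule.mem_top
    change ∑ g, (x i - w i).coeff g = 0
    have h1 := hwx i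
    have h2 : ∀ g, (x i - w i).coeff g = (x i).coeff g - (w i).coeff g := fun g => rfl
    simp only [h2, Finset.sum_sub_distrib, h1, sub_self]
  ext x
  exact ⟨fun _ => trivial, fun _ => htop (Submodule.mem_top (x := x))⟩

/-- The functionals on `(ZMod p)[G] ^ k` invariant under the `c j` are norms along the `c j`, if
there is a function on `G` whose translates by the `c j` sum to one. -/
theorem exists_sum_eq_of_invariant {k : ℕ} {ι : Type*} (s : Finset ι) (c : ι → G) (θ : G → ZMod p)
    (hθ : ∀ g, ∑ j ∈ s, θ ((c j)⁻¹ * g) = 1)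
    (l : (Fin k → MonoidAlgebra (ZMod p) G) →+ ZMod p)
    (hl : ∀ j ∈ s, ∀ x, l (fun i => MonoidAlgebra.of (ZMod p) G (c j)⁻¹ * x i) = l x) :
    ∃ m : (Fin k → MonoidAlgebra (ZMod p) G) →+ ZMod p,
      ∀ x, l x = ∑ j ∈ s, m (fun i => MonoidAlgebra.of (ZMod p) G (c j)⁻¹ * x i) := by
  let scale : (G → ZMod p) → (Fin k → MonoidAlgebra (ZMod p) G) →
      (Fin k → MonoidAlgebra (ZMod p) G) := fun f x i =>
    .ofCoeff (Finsupp.equivFunOnFinite.symm fun g => f g * (x i).coeff g)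
  have hscale : ∀ f x i g, (scale f x i).coeff g = f g * (x i).coeff g := fun f x i g => rfl
  have hext : ∀ x y : Fin k → MonoidAlgebra (ZMod p) G, (∀ i g, (x i).coeff g = (y i).coeff g) →
      x = y := fun x y h => funext fun i => MonoidAlgebra.ext (Finsupp.ext (h i))
  -- Weighting coefficients by `θ` before applying `l`: invariance of `l` moves the translations
  -- onto `θ`, and the translates of `θ` sum to one.
  let m : (Fin k → MonoidAlgebra (ZMod p) G) →+ ZMod p := AddMonoidHom.mk' (fun x => l (scale θ x))
    fun x y => by
      rw [← map_add]
      congr 1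
      refine hext _ _ fun i g => ?_
      simp only [Pi.add_apply, MonoidAlgebra.coeff_add, Finsupp.add_apply, hscale, mul_add]
  refine ⟨m, fun x => ?_⟩
  have h1 : ∀ j ∈ s, m (fun i => MonoidAlgebra.of (ZMod p) G (c j)⁻¹ * x i) =
      l (scale (fun g => θ ((c j)⁻¹ * g)) x) := by
    intro j hj
    rw [← hl j hj (scale (fun g => θ ((c j)⁻¹ * g)) x)]
    change l _ = l _
    congr 1
    refine hext _ _ fun i g => ?_
    simp only [hscale, MonoidAlgebra.coeff_of_mul_apply, inv_inv, inv_mul_cancel_left]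
  rw [Finset.sum_congr rfl h1, ← map_sum]
  congr 1
  refine hext _ _ fun i g => ?_
  simp only [Finset.sum_apply, MonoidAlgebra.coeff_sum, Finsupp.finsetSum_apply, hscale]
  rw [← Finset.sum_mul, hθ, one_mul]

open Classical in
/-- The indicator function of a transversal of the subgroup generated by `a`. -/
theorem exists_sum_translates_eq_one {a : G} (ha : orderOf a = p) :
    ∃ θ : G → ZMod p, ∀ g, ∑ j ∈ Finset.range p, θ ((a ^ j)⁻¹ * g) = 1 := by
  let out : G → G := fun g => (QuotientGroup.mk g : G ⧸ Subgroup.zpowers a).out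
  have hout : ∀ g (j : ℕ), out ((a ^ j)⁻¹ * g) = out g := fun g j => by
    simp only [out]
    congr 1
    rw [eq_comm, mul_comm, QuotientGroup.eq, inv_mul_cancel_left]
    exact inv_mem (Subgroup.npow_mem_zpowers a j)
  refine ⟨fun g => if out g = g then 1 else 0, fun g => ?_⟩
  simp only [hout]
  have h1 : (out g)⁻¹ * g ∈ Subgroup.zpowers a := by
    rw [← QuotientGroup.eq]
    exact QuotientGroup.out_eq' _
  rw [← mem_powers_iff_mem_zpowers, mem_powers_iff_mem_range_orderOf, ha] at h1
  obtain ⟨j, hj, hja⟩ := Finset.mem_image.1 h1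
  have hval : out g = (a ^ j)⁻¹ * g := by
    rw [hja]
    group
    simp [mul_comm]
  rw [Finset.sum_eq_single_of_mem j hj, if_pos hval]
  intro i hi hij
  rw [if_neg]
  rw [hval]
  intro h
  apply hij
  have h2 := inv_injective (mul_right_cancel h)
  rw [Finset.mem_range] at hi hj
  exact (pow_injOn_Iio_orderOf (by simpa [ha] using hj) (by simpa [ha] using hi) h2).symm

end GroupAlgebra

/-! ### Homomorphisms to the semidirect product -/

section InducedHom

variable {p : ℕ} {G : Type*} [CommGroup G] {Ω : Type*} [Group Ω]

theorem FreeModuleSemidirect.ext_coeff {k : ℕ} {a b : FreeModuleSemidirect (ZMod p) G k}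
    (hl : ∀ i g, (a.left.toAdd i).coeff g = (b.left.toAdd i).coeff g) (hr : a.right = b.right) :
    a = b :=
  SemidirectProduct.ext (Multiplicative.toAdd.injective
    (funext fun i => MonoidAlgebra.ext (Finsupp.ext (hl i)))) hr

theorem FreeModuleSemidirect.coeff_mul {k : ℕ} (a b : FreeModuleSemidirect (ZMod p) G k)
    (i : Fin k) (g : G) : ((a * b).left.toAdd i).coeff g =
      (a.left.toAdd i).coeff g + (b.left.toAdd i).coeff (a.right⁻¹ * g) := by
  rw [← MonoidAlgebra.coeff_of_mul_apply]
  rfl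

/-- The homomorphism to the semidirect product induced by additive functions on the kernel of
`π`. -/
theorem exists_induced_hom [Finite G] {k : ℕ} (π : Ω →* G) (s : G → Ω) (hs : ∀ g, π (s g) = g)
    (u : Fin k → Ω → ZMod p)
    (hu : ∀ i, ∀ g ∈ π.ker, ∀ h ∈ π.ker, u i (g * h) = u i g + u i h) :
    ∃ Ψ : Ω →* FreeModuleSemidirect (ZMod p) G k, (∀ τ, (Ψ τ).right = π τ) ∧
      ∀ h ∈ π.ker, ∀ i g, ((Ψ h).left.toAdd i).coeff g = u i ((s g)⁻¹ * h * s g) := by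
  -- The Shapiro cocycle: `(s g)⁻¹ * τ * s ((π τ)⁻¹ * g)` lies in the kernel of `π` for every `τ`.
  let f : Ω → FreeModuleSemidirect (ZMod p) G k := fun τ =>
    ⟨Multiplicative.ofAdd fun i => .ofCoeff (Finsupp.equivFunOnFinite.symm fun g =>
      u i ((s g)⁻¹ * τ * s ((π τ)⁻¹ * g))), π τ⟩
  have hf : ∀ τ i g, ((f τ).left.toAdd i).coeff g = u i ((s g)⁻¹ * τ * s ((π τ)⁻¹ * g)) :=
    fun τ i g => rfl
  refine ⟨MonoidHom.mk' f fun a b => ?_, fun τ => rfl, fun h hh i g => ?_⟩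
  · refine FreeModuleSemidirect.ext_coeff (fun i g => ?_) (map_mul π a b)
    rw [FreeModuleSemidirect.coeff_mul, hf, hf, hf, ← hu]
    · congr 1
      simp only [f, map_mul, mul_inv_rev]
      group
    · simp [MonoidHom.mem_ker, hs]
    · simp [MonoidHom.mem_ker, hs, f]
  · change ((f h).left.toAdd i).coeff g = _
    rw [hf, show π h = 1 from hh]
    simp

/-- A homomorphism to the semidirect product is surjective if it is so modulo the augmentation. -/
theorem surjective_of_sum_coeff_surjective [Fact p.Prime] [Fintype G] (hG : IsPGroup p G) {k : ℕ}
    (Ψ : Ω →* FreeModuleSemidirect (ZMod p) G k)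
    (hright : ∀ g, ∃ τ, (Ψ τ).right = g)
    (hsurj : ∀ y : Fin k → ZMod p, ∃ h, (Ψ h).right = 1 ∧
      ∀ i, ∑ g, ((Ψ h).left.toAdd i).coeff g = y i) : Function.Surjective Ψ := by
  let R : AddSubgroup (Fin k → MonoidAlgebra (ZMod p) G) :=
    { carrier := {x | SemidirectProduct.inl (Multiplicative.ofAdd x) ∈ Ψ.range}
      add_mem' := fun {x y} hx hy => by
        simp only [Set.mem_ofPred_eq, ofAdd_add, map_mul] at *
        exact mul_mem hx hy
      zero_mem' := by
        simp only [Set.mem_ofPred_eq, ofAdd_zero, map_one]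
        exact one_mem _
      neg_mem' := fun {x} hx => by
        simp only [Set.mem_ofPred_eq, ofAdd_neg, map_inv] at *
        exact inv_mem hx }
  have hR : R = ⊤ := by
    refine addSubgroup_eq_top_of_sum_coeff_surjective hG R ?_ ?_
    · rintro x ⟨h, hh⟩ g
      obtain ⟨τ, hτ⟩ := hright g
      refine ⟨τ * h * τ⁻¹, ?_⟩
      rw [map_mul, map_mul, hh, map_inv]
      have h1 := SemidirectProduct.inl_left_mul_inr_right (Ψ τ)
      rw [hτ] at h1
      have h2 : (SemidirectProduct.inl (Multiplicative.ofAdd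
          fun i => MonoidAlgebra.of (ZMod p) G g * x i) : FreeModuleSemidirect (ZMod p) G k) =
          SemidirectProduct.inr g * SemidirectProduct.inl (Multiplicative.ofAdd x) *
            (SemidirectProduct.inr g)⁻¹ := by
        rw [← map_inv]
        exact SemidirectProduct.inl_aut g (Multiplicative.ofAdd x)
      rw [h2, ← h1, mul_inv_rev]
      -- The module part is abelian, so conjugation by `Ψ τ` acts on it through the right component
      -- alone.
      have h3 : ∀ v w : Multiplicative (Fin k → MonoidAlgebra (ZMod p) G),
          (SemidirectProduct.inl v * SemidirectProduct.inl w * (SemidirectProduct.inl v)⁻¹ :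
            FreeModuleSemidirect (ZMod p) G k) = SemidirectProduct.inl w := fun v w => by
        rw [← map_mul, mul_comm v w, map_mul, mul_inv_cancel_right]
      have h4 := h3 (Ψ τ).left (freeModuleAction (ZMod p) G k g (Multiplicative.ofAdd x))
      rw [SemidirectProduct.inl_aut, map_inv] at h4
      rw [← h4]
      group
    · intro y
      obtain ⟨h, h1, h2⟩ := hsurj y
      refine ⟨(Ψ h).left.toAdd, ⟨h, ?_⟩, h2⟩
      have := SemidirectProduct.inl_left_mul_inr_right (Ψ h)
      rw [h1, map_one, mul_one] at this
      exact this.symm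
  intro e
  have hinl : ∀ x, SemidirectProduct.inl x ∈ Ψ.range := fun x => by
    have : x.toAdd ∈ R := by rw [hR]; trivial
    exact this
  obtain ⟨τ, hτ⟩ := hright e.right
  obtain ⟨σ, hσ⟩ := hinl (e.left * (Ψ τ).left⁻¹)
  refine ⟨σ * τ, ?_⟩
  rw [map_mul, hσ, ← SemidirectProduct.inl_left_mul_inr_right (Ψ τ), hτ, ← mul_assoc, ← map_mul]
  simp only [SemidirectProduct.left_inl, SemidirectProduct.mul_left, SemidirectProduct.right_inl,
    map_one, SemidirectProduct.left_inr, mul_one, inv_mul_cancel_right]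
  exact SemidirectProduct.inl_left_mul_inr_right e

end InducedHom

/-! ### Norm-zero characters and twisted surjections -/

section Characters

variable {p : ℕ} {G : Type*} [CommGroup G] {Ω : Type*} [Group Ω]
  {k : ℕ} {Ψ : Ω →* FreeModuleSemidirect (ZMod p) G k}

/-- The additive part of a homomorphism to the semidirect product, on the kernel of the
projection. -/
theorem left_mul_of_mem_ker {g h : Ω} (hg : g ∈ (SemidirectProduct.rightHom.comp Ψ).ker) :
    (Ψ (g * h)).left.toAdd = (Ψ g).left.toAdd + (Ψ h).left.toAdd := by
  have hg' : (Ψ g).right = 1 := hg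
  rw [map_mul, SemidirectProduct.mul_left, hg', map_one, MulAut.one_apply, toAdd_mul]

theorem left_conj_of_mem_ker {h : Ω} (hh : h ∈ (SemidirectProduct.rightHom.comp Ψ).ker) (c : Ω) :
    (Ψ (c⁻¹ * h * c)).left.toAdd =
      fun i => MonoidAlgebra.of (ZMod p) G (Ψ c).right⁻¹ * (Ψ h).left.toAdd i := by
  have hh' : (Ψ h).right = 1 := hh
  funext i
  refine MonoidAlgebra.ext (Finsupp.ext fun g => ?_)
  have h1 : c * (c⁻¹ * h * c) = h * c := by group
  have h2 := congrArg (fun e => (e.left.toAdd i).coeff ((Ψ c).right * g)) (congrArg Ψ h1)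
  simp only [map_mul Ψ c, map_mul Ψ h c, FreeModuleSemidirect.coeff_mul, inv_mul_cancel_left, hh',
    inv_one, one_mul] at h2
  rw [MonoidAlgebra.coeff_of_mul_apply, inv_inv]
  rw [add_comm] at h2
  exact add_right_cancel h2

theorem exists_mem_ker_left_eq (hΨ : Function.Surjective Ψ)
    (x : Fin k → MonoidAlgebra (ZMod p) G) :
    ∃ h ∈ (SemidirectProduct.rightHom.comp Ψ).ker, (Ψ h).left.toAdd = x := by
  obtain ⟨h, hh⟩ := hΨ (SemidirectProduct.inl (Multiplicative.ofAdd x))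
  refine ⟨h, ?_, ?_⟩
  · rw [MonoidHom.mem_ker, MonoidHom.comp_apply, hh, SemidirectProduct.rightHom_inl]
  · rw [hh]; rfl

variable [TopologicalSpace Ω]

theorem isCharacter_comp_left [IsTopologicalGroup Ω] (hopen : IsOpen (Ψ.ker : Set Ω))
    (l : (Fin k → MonoidAlgebra (ZMod p) G) →+ ZMod p) :
    IsCharacter p (SemidirectProduct.rightHom.comp Ψ).ker fun h => l (Ψ h).left.toAdd := by
  refine IsCharacter.of_open (fun g hg h _ => ?_) hopen Ψ.ker.one_mem fun h hh => ?_
  · rw [left_mul_of_mem_ker hg, map_add]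
  · have hh' : Ψ h = 1 := hh
    refine ⟨?_, ?_⟩
    · rw [MonoidHom.mem_ker, MonoidHom.comp_apply, hh', map_one]
    · rw [hh']
      exact map_zero l

/-- The left component identifies the kernel of the projection modulo `Ψ.ker` with the free module.
-/
theorem IsCharacter.exists_comp_left (hΨ : Function.Surjective Ψ) {v : Ω → ZMod p}
    (hv : IsCharacter p (SemidirectProduct.rightHom.comp Ψ).ker v) (hv0 : ∀ h ∈ Ψ.ker, v h = 0) :
    ∃ l : (Fin k → MonoidAlgebra (ZMod p) G) →+ ZMod p,
      ∀ h ∈ (SemidirectProduct.rightHom.comp Ψ).ker, v h = l (Ψ h).left.toAdd := by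
  choose r hr hrx using exists_mem_ker_left_eq hΨ
  have key : ∀ g ∈ (SemidirectProduct.rightHom.comp Ψ).ker,
      ∀ h ∈ (SemidirectProduct.rightHom.comp Ψ).ker,
      (Ψ g).left.toAdd = (Ψ h).left.toAdd → v g = v h := by
    intro g hg h hh hgh
    have h1 : Ψ g = Ψ h := SemidirectProduct.ext (Multiplicative.toAdd.injective hgh)
      ((show (Ψ g).right = 1 from hg).trans (show (Ψ h).right = 1 from hh).symm)
    have h2 := hv0 (g⁻¹ * h) (by rw [MonoidHom.mem_ker, map_mul, _root_.map_inv, h1, inv_mul_cancel])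
    rw [hv.1 _ (inv_mem hg) _ hh, hv.map_inv hg] at h2
    linear_combination -h2
  refine ⟨AddMonoidHom.mk' (fun x => v (r x)) fun x y => ?_, fun h hh => ?_⟩
  · rw [← hv.1 _ (hr x) _ (hr y)]
    refine key _ (hr _) _ (mul_mem (hr x) (hr y)) ?_
    rw [left_mul_of_mem_ker (hr x), hrx, hrx, hrx]
  · exact key _ hh _ (hr _) (hrx _).symm

/-- If some invariant character of `X` is not a norm, there is a character of norm zero which does
not vanish on the kernel of `Ψ`. -/
theorem exists_character_norm_eq_zero [IsTopologicalGroup Ω] [Fact p.Prime] [Fintype G]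
    (hG : IsPGroup p G) (hΨ : Function.Surjective Ψ)
    (hopen : IsOpen (Ψ.ker : Set Ω)) (s : G → Ω)
    (hs : ∀ g, (SemidirectProduct.rightHom.comp Ψ) (s g) = g) {t : Ω}
    (ht : t ∉ (SemidirectProduct.rightHom.comp Ψ).ker)
    (htp : t ^ p ∈ (SemidirectProduct.rightHom.comp Ψ).ker)
    (hnon : HasInvariantNonNorm p (SemidirectProduct.rightHom.comp Ψ).ker t) :
    ∃ u : Ω → ZMod p, IsCharacter p (SemidirectProduct.rightHom.comp Ψ).ker u ∧
      (∀ h ∈ (SemidirectProduct.rightHom.comp Ψ).ker, ∑ g, u ((s g)⁻¹ * h * s g) = 0) ∧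
      ∃ h ∈ Ψ.ker, u h ≠ 0 := by
  classical
  set π : Ω →* G := SemidirectProduct.rightHom.comp Ψ with hπ
  have hker : Ψ.ker ≤ π.ker := fun h hh => by
    rw [MonoidHom.mem_ker, hπ, MonoidHom.comp_apply, (show Ψ h = 1 from hh), map_one]
  have hconj : ∀ c, ∀ h ∈ π.ker, c⁻¹ * h * c ∈ π.ker := fun c h hh => by
    simpa using Subgroup.Normal.conj_mem inferInstance h hh c⁻¹
  have hπt : π t ≠ 1 := ht
  have hcard : ((Fintype.card G : ℕ) : ZMod p) = 0 := by
    obtain ⟨m, hm⟩ := IsPGroup.iff_card.1 hG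
    rw [← Nat.card_eq_fintype_card, hm]
    have : m ≠ 0 := by
      rintro rfl
      rw [pow_zero, Nat.card_eq_one_iff_unique] at hm
      have := hm.1
      exact hπt (Subsingleton.elim _ _)
    simp [this]
  by_contra! hcon
  have hconst : ∀ v : Ω → ZMod p, IsCharacter p π.ker v → ∀ (c : Ω), ∀ h ∈ Ψ.ker,
      v (c⁻¹ * h * c) = v h := by
    intro v hv c h hh
    -- A conjugate minus the character itself has norm zero: right translation by `π c` permutes the
    -- summands.
    have h1 := hcon _ ((hv.conj c).sub hv) (by
      intro x hx
      rw [Finset.sum_sub_distrib, sub_eq_zero]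
      refine Fintype.sum_equiv (Equiv.mulRight (π c)) _ _ fun g => ?_
      have h2 := hv.conj_eq_of_inv_mul_mem (a := s g * c) (b := s (g * π c)) (h := x)
        (by rw [MonoidHom.mem_ker, map_mul, map_inv, map_mul, hs, hs, inv_mul_cancel]) hx
      rw [Equiv.coe_mulRight, ← h2]
      congr 1
      group) h hh
    exact sub_eq_zero.1 h1
  have hzero : ∀ v : Ω → ZMod p, IsCharacter p π.ker v → ∀ h ∈ Ψ.ker, v h = 0 := by
    intro v hv
    have hNv : IsCharacter p π.ker fun h => ∑ g, v ((s g)⁻¹ * h * s g) := by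
      have : ∀ S : Finset G, IsCharacter p π.ker fun h => ∑ g ∈ S, v ((s g)⁻¹ * h * s g) := by
        intro S
        induction S using Finset.induction_on with
        | empty => simpa using hv.const_mul 0
        | insert a S ha ih =>
          simp only [Finset.sum_insert ha]
          exact (hv.conj (s a)).add ih
      exact this _
    -- On `Ψ.ker` all conjugates of `v` agree, so the norm is `|G| * v = 0` and descends to the free
    -- module.
    obtain ⟨l, hl⟩ := hNv.exists_comp_left hΨ fun h hh => by
      rw [Finset.sum_congr rfl fun g _ => hconst v hv (s g) h hh]
      simp [hcard]
    obtain ⟨m, hm⟩ := exists_sum_eq_of_invariant Finset.univ (fun g : G => g)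
      (fun g => if g = 1 then 1 else 0) (fun g => by
        rw [Finset.sum_eq_single g]
        · simp
        · intro b _ hb
          rw [if_neg]
          intro h
          exact hb (inv_mul_eq_one.1 h)
        · simp) l (fun g _ x => by
        obtain ⟨h, hh, rfl⟩ := exists_mem_ker_left_eq hΨ x
        have h1 := left_conj_of_mem_ker hh (s g)
        rw [show (Ψ (s g)).right = g from hs g] at h1
        rw [← h1, ← hl _ (hconj _ h hh), ← hl h hh]
        refine Fintype.sum_equiv (Equiv.mulLeft g) _ _ fun b => ?_
        have h2 := hv.conj_eq_of_inv_mul_mem (a := s g * s b) (b := s (g * b)) (h := h)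
          (by rw [MonoidHom.mem_ker, map_mul, map_inv, map_mul, hs, hs, hs, inv_mul_cancel]) hh
        rw [Equiv.coe_mulLeft, ← h2]
        congr 1
        group)
    have hw := isCharacter_comp_left hopen m
    intro h hh
    -- The descended norm of `v` is also the norm of a functional `m` on the free module. The
    -- difference of `v` and the character of `m` has norm zero, so `v` vanishes on `Ψ.ker` as well.
    have h1 := hcon _ (hv.sub hw) (fun x hx => by
      rw [Finset.sum_sub_distrib, hl x hx, hm, sub_eq_zero]
      refine Finset.sum_congr rfl fun g _ => ?_
      rw [left_conj_of_mem_ker hx (s g), show (Ψ (s g)).right = g from hs g]) h hh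
    rw [sub_eq_zero] at h1
    rw [h1, show Ψ h = 1 from hh]
    exact map_zero m
  obtain ⟨u, hu, huinv, hne⟩ := hnon
  obtain ⟨l, hl⟩ := hu.exists_comp_left hΨ (hzero u hu)
  have horder : orderOf (π t) = p := orderOf_eq_prime (by
    rw [← map_pow]
    exact htp) hπt
  obtain ⟨θ, hθ⟩ := exists_sum_translates_eq_one horder
  have huinv' : ∀ j : ℕ, ∀ h ∈ π.ker, u ((t ^ j)⁻¹ * h * t ^ j) = u h := by
    intro j
    induction j with
    | zero => simp
    | succ j ih =>
      intro h hh
      rw [← ih h hh, ← huinv _ (hconj (t ^ j) h hh)]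
      congr 1
      rw [pow_succ]
      group
  have hπj : ∀ j : ℕ, (Ψ (t ^ j)).right = π t ^ j := fun j => map_pow π t j
  -- Every character now comes from the free module, where invariants under `t` are norms along `t`;
  -- this contradicts the choice of `u`.
  obtain ⟨m, hm⟩ := exists_sum_eq_of_invariant (Finset.range p) (fun j => π t ^ j) θ hθ l
    (fun j _ x => by
      obtain ⟨h, hh, rfl⟩ := exists_mem_ker_left_eq hΨ x
      have h1 := left_conj_of_mem_ker hh (t ^ j)
      rw [hπj] at h1
      rw [← h1, ← hl _ (hconj _ h hh), ← hl h hh, huinv' j h hh])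
  refine hne _ (isCharacter_comp_left hopen m) fun h hh => ?_
  rw [hl h hh, hm]
  refine Finset.sum_congr rfl fun j _ => ?_
  rw [left_conj_of_mem_ker hh (t ^ j), hπj]

theorem finite_freeModuleSemidirect (p : ℕ) [Fact p.Prime] (G : Type*) [CommGroup G] [Finite G]
    (k : ℕ) : Finite (FreeModuleSemidirect (ZMod p) G k) := by
  have : Finite (G →₀ ZMod p) := Finite.of_injective _ (DFunLike.coe_injective)
  have : Finite (MonoidAlgebra (ZMod p) G) :=
    Finite.of_injective _ MonoidAlgebra.coeff_injective
  have : Finite (Multiplicative (Fin k → MonoidAlgebra (ZMod p) G)) :=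
    inferInstanceAs (Finite (Fin k → MonoidAlgebra (ZMod p) G))
  exact Finite.of_equiv _ SemidirectProduct.equivProd.symm

/-- A character of norm zero not vanishing on `Ψ.ker` yields `p ^ k` homomorphisms with the same
projection and pairwise distinct kernels. -/
theorem exists_family_of_norm_eq_zero [IsTopologicalGroup Ω] [Fact p.Prime] [Fintype G]
    (hG : IsPGroup p G) (hΨ : Function.Surjective Ψ)
    (hopen : IsOpen (Ψ.ker : Set Ω)) (s : G → Ω)
    (hs : ∀ g, (SemidirectProduct.rightHom.comp Ψ) (s g) = g) {u : Ω → ZMod p}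
    (hu : IsCharacter p (SemidirectProduct.rightHom.comp Ψ).ker u)
    (hNu : ∀ h ∈ (SemidirectProduct.rightHom.comp Ψ).ker, ∑ g, u ((s g)⁻¹ * h * s g) = 0)
    {h₀ : Ω} (hh₀ : h₀ ∈ Ψ.ker) (hne : u h₀ ≠ 0) :
    ∃ Φ : (Fin k → ZMod p) → (Ω →* FreeModuleSemidirect (ZMod p) G k),
      (∀ c τ, (Φ c τ).right = (Ψ τ).right) ∧ (∀ c, Function.Surjective (Φ c)) ∧
      (∀ c, IsOpen ((Φ c).ker : Set Ω)) ∧ Function.Injective fun c => (Φ c).ker := by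
  set π : Ω →* G := SemidirectProduct.rightHom.comp Ψ with hπ
  have hconj : ∀ c, ∀ h ∈ π.ker, c⁻¹ * h * c ∈ π.ker := fun c h hh => by
    simpa using Subgroup.Normal.conj_mem inferInstance h hh c⁻¹
  let l : Fin k → ((Fin k → MonoidAlgebra (ZMod p) G) →+ ZMod p) := fun i =>
    AddMonoidHom.mk' (fun x => (x i).coeff 1) fun x y => rfl
  let w : Fin k → Ω → ZMod p := fun i h => l i (Ψ h).left.toAdd
  have hw : ∀ i, IsCharacter p π.ker (w i) := fun i => isCharacter_comp_left hopen (l i)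
  have hwconj : ∀ i, ∀ h ∈ π.ker, ∀ g, w i ((s g)⁻¹ * h * s g) =
      ((Ψ h).left.toAdd i).coeff g := fun i h hh g => by
    change ((Ψ ((s g)⁻¹ * h * s g)).left.toAdd i).coeff 1 = _
    rw [left_conj_of_mem_ker hh (s g), show (Ψ (s g)).right = g from hs g,
      MonoidAlgebra.coeff_of_mul_apply, inv_inv, mul_one]
  have hcu : ∀ (c : Fin k → ZMod p) i, IsCharacter p π.ker fun h => w i h + c i * u h :=
    fun c i => (hw i).add (hu.const_mul (c i))
  choose Φ hΦr hΦl using fun c : Fin k → ZMod p =>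
    exists_induced_hom π s hs (fun i h => w i h + c i * u h) fun i => (hcu c i).1
  have hsurj : ∀ c, Function.Surjective (Φ c) := by
    intro c
    refine surjective_of_sum_coeff_surjective hG (Φ c) (fun g => ⟨s g, (hΦr c _).trans (hs g)⟩) ?_
    intro y
    obtain ⟨h, hh, hhy⟩ := exists_mem_ker_left_eq hΨ fun i => MonoidAlgebra.single 1 (y i)
    refine ⟨h, (hΦr c h).trans hh, fun i => ?_⟩
    simp only [hΦl c h hh i]
    -- The twist changes each augmentation by a multiple of the norm of `u`, which is zero.
    rw [Finset.sum_add_distrib, ← Finset.mul_sum, hNu h hh, mul_zero, add_zero,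
      Finset.sum_congr rfl fun g _ => hwconj i h hh g, hhy]
    classical
    simp [Finsupp.single_apply]
  have hΦker : ∀ c, (Φ c).ker ≤ π.ker := fun c h hh => by
    rw [MonoidHom.mem_ker, ← hΦr c h, show Φ c h = 1 from hh]
    rfl
  have hmem : ∀ c h, h ∈ (Φ c).ker ↔ h ∈ π.ker ∧
      ∀ i g, w i ((s g)⁻¹ * h * s g) + c i * u ((s g)⁻¹ * h * s g) = 0 := by
    intro c h
    constructor
    · intro hh
      refine ⟨hΦker c hh, fun i g => ?_⟩
      rw [← hΦl c h (hΦker c hh) i g, show Φ c h = 1 from hh]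
      rfl
    · rintro ⟨h1, h2⟩
      refine FreeModuleSemidirect.ext_coeff (fun i g => ?_) ((hΦr c h).trans h1)
      rw [hΦl c h h1 i g, h2]
      rfl
  refine ⟨Φ, hΦr, hsurj, fun c => ?_, ?_⟩
  · have hZ : IsOpen ((Ψ.ker : Set Ω) ∩ ⋂ i, ⋂ g, (fun x => (s g)⁻¹ * x * s g) ⁻¹'
        {h | h ∈ π.ker ∧ w i h + c i * u h = 0}) :=
      hopen.inter (isOpen_iInter_of_finite fun i => isOpen_iInter_of_finite fun g =>
        (hcu c i).2.preimage (by fun_prop))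
    refine Subgroup.isOpen_of_mem_nhds _ (g := 1) (Filter.mem_of_superset (hZ.mem_nhds ?_) ?_)
    · refine ⟨one_mem _, Set.mem_iInter₂.2 fun i g => ?_⟩
      have := (hcu c i).map_one
      simpa using this
    · rintro h ⟨h1, h2⟩
      have hh : h ∈ π.ker := by
        rw [MonoidHom.mem_ker, hπ, MonoidHom.comp_apply, (show Ψ h = 1 from h1), map_one]
      exact (hmem c h).2 ⟨hh, fun i g => ((Set.mem_iInter₂.1 h2) i g).2⟩
  · intro c c' hcc
    by_contra hcne
    obtain ⟨i, hi⟩ : ∃ i, c i ≠ c' i := by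
      by_contra! h
      exact hcne (funext h)
    have hcc' : (Φ c).ker = (Φ c').ker := hcc
    have hval : ∀ j h, h ∈ (Φ c).ker → ∀ g, u ((s g)⁻¹ * h * s g) = 0 ∧
        w j ((s g)⁻¹ * h * s g) = 0 := by
      intro j h hh g
      have h1 := ((hmem c h).1 hh).2
      have h2 := ((hmem c' h).1 (hcc' ▸ hh)).2
      have h3 : u ((s g)⁻¹ * h * s g) = 0 := by
        have : (c i - c' i) * u ((s g)⁻¹ * h * s g) = 0 := by
          linear_combination h1 i g - h2 i g
        exact (mul_eq_zero.1 this).resolve_left (sub_ne_zero.2 hi)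
      refine ⟨h3, ?_⟩
      have := h1 j g
      rwa [h3, mul_zero, add_zero] at this
    -- If two kernels agree, `u` and then every `w j` vanish on all relevant conjugates. Equal
    -- finite indices turn the inclusion into equality, contradicting `u h₀ ≠ 0`.
    have hle : (Φ c).ker ≤ Ψ.ker := by
      intro h hh
      refine FreeModuleSemidirect.ext_coeff (fun j g => ?_) (hΦker c hh)
      rw [← hwconj j h (hΦker c hh) g, (hval j h hh g).2]
      rfl
    have hfin := finite_freeModuleSemidirect p G k
    have hindex : (Φ c).ker.index = Ψ.ker.index := by
      rw [Subgroup.index_ker, Subgroup.index_ker, MonoidHom.range_eq_top.2 (hsurj c),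
        MonoidHom.range_eq_top.2 hΨ]
    have hindex0 : Ψ.ker.index ≠ 0 := by
      rw [Subgroup.index_ker]
      exact Nat.card_pos.ne'
    have hrel := Subgroup.relIndex_mul_index hle
    rw [hindex] at hrel
    have hrel1 : (Φ c).ker.relIndex Ψ.ker = 1 := by
      exact Nat.eq_of_mul_eq_mul_right (Nat.pos_of_ne_zero hindex0) (by rw [hrel, one_mul])
    have hge := Subgroup.relIndex_eq_one.1 hrel1
    have hu0 := (hval i h₀ (hge hh₀) 1).1
    -- The section need not send `1` to `1`; conjugation by `s 1` is still harmless.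
    have hs1 : s 1 ∈ π.ker := hs 1
    rw [hu.map_conj hs1 (hΦker c (hge hh₀))] at hu0
    exact hne hu0

end Characters

/-- A surjection from the Galois group of a separably closed Galois extension onto
`(ZMod p)[G] ^ k ⋊ G` comes with `p ^ k` such surjections with the same projection to `G` and
pairwise distinct kernels. -/
theorem exists_family_of_surjective {p n k : ℕ} [Fact p.Prime] (hn : 1 ≤ n) (hn2 : p = 2 → 2 ≤ n)
    {F S : Type*} [Field F] [Field S] [Algebra F S] [IsGalois F S] [IsSepClosed S]
    (Ψ : Gal(S/F) →* FreeModuleSemidirect (ZMod p) (CyclicPPow p n) k)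
    (hΨ : Function.Surjective Ψ) (hopen : IsOpen (Ψ.ker : Set Gal(S/F))) :
    ∃ Φ : (Fin k → ZMod p) →
        (Gal(S/F) →* FreeModuleSemidirect (ZMod p) (CyclicPPow p n) k),
      (∀ c τ, (Φ c τ).right = (Ψ τ).right) ∧ (∀ c, Function.Surjective (Φ c)) ∧
      (∀ c, IsOpen ((Φ c).ker : Set Gal(S/F))) ∧ Function.Injective fun c => (Φ c).ker := by
  have hp := (Fact.out : p.Prime)
  have : NeZero (p ^ n) := ⟨pow_ne_zero _ hp.ne_zero⟩
  have hG : IsPGroup p (CyclicPPow p n) :=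
    IsPGroup.of_card (n := n) ((Nat.card_congr Multiplicative.toAdd).trans (Nat.card_zmod _))
  choose s hs using SemidirectProduct.rightHom_surjective.comp hΨ
  let π : Gal(S/F) →* CyclicPPow p n := SemidirectProduct.rightHom.comp Ψ
  have hπs : ∀ g, π (s g) = g := hs
  have hX : IsOpen (π.ker : Set Gal(S/F)) := by
    refine Subgroup.isOpen_mono (fun h hh => ?_) hopen
    rw [MonoidHom.mem_ker, MonoidHom.comp_apply, (show Ψ h = 1 from hh), map_one]
  set t₀ := s (Multiplicative.ofAdd 1) with ht₀
  have hpow : ∀ i : ℕ, t₀ ^ i ∈ π.ker ↔ p ^ n ∣ i := fun i => by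
    rw [MonoidHom.mem_ker, map_pow, ht₀, hπs, ← ofAdd_nsmul, ofAdd_eq_one, nsmul_one,
      ZMod.natCast_eq_zero_iff]
  -- This power of a lift of the generator has order `p` in `G`, and for `p = 2` it is a square
  -- because `n ≥ 2`.
  obtain ⟨t, ht, htp, hnon⟩ := exists_hasInvariantNonNorm (p := p) hX (t₁ := t₀ ^ p ^ (n - 1))
    (by
      rw [hpow, Nat.pow_dvd_pow_iff_le_right hp.one_lt]
      omega)
    (by
      rw [← pow_mul, ← pow_succ, hpow, Nat.sub_add_cancel hn])
    (by
      rintro rfl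
      refine ⟨t₀ ^ 2 ^ (n - 2), ?_⟩
      rw [← pow_mul, ← pow_succ]
      congr 2
      have := hn2 rfl
      omega)
  obtain ⟨u, hu, hNu, h₀, hh₀, hne⟩ :=
    exists_character_norm_eq_zero hG hΨ hopen s hs ht htp hnon
  exact exists_family_of_norm_eq_zero hG hΨ hopen s hs hu hNu hh₀ hne

theorem exists_mulEquiv_of_ker_eq {A B C : Type*} [Group A] [Group B] [Group C] {f : A →* B}
    {g : A →* C} (hf : Function.Surjective f) (hg : Function.Surjective g) (h : f.ker = g.ker) :
    ∃ e : B ≃* C, ∀ a, e (f a) = g a := by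
  let e : B ≃* C := (QuotientGroup.quotientKerEquivOfSurjective f hf).symm.trans
    ((QuotientGroup.quotientMulEquivOfEq h).trans
      (QuotientGroup.quotientKerEquivOfSurjective g hg))
  refine ⟨e, fun a => ?_⟩
  have : (QuotientGroup.quotientKerEquivOfSurjective f hf).symm (f a) = QuotientGroup.mk a := by
    rw [MulEquiv.symm_apply_eq]
    rfl
  change QuotientGroup.quotientKerEquivOfSurjective g hg (QuotientGroup.quotientMulEquivOfEq h
    ((QuotientGroup.quotientKerEquivOfSurjective f hf).symm (f a))) = g a
  rw [this]
  rfl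

/-! ### Galois extensions as kernels of surjections -/

section Translation

variable {F : Type u} [Field F]

/-- Galois subextensions of the algebraic closure and surjections from the Galois group of the
separable closure. -/
theorem exists_hom_of_isGalois {E : Type*} [Group E] [Finite E]
    (L : IntermediateField F (AlgebraicClosure F)) [IsGalois F L] (ψ : Gal(L/F) ≃* E) :
    ∃ Ψ : Gal(separableClosure F (AlgebraicClosure F)/F) →* E, Function.Surjective Ψ ∧
      IsOpen (Ψ.ker : Set Gal(separableClosure F (AlgebraicClosure F)/F)) ∧
      ∀ (τ) (x : L) (y : separableClosure F (AlgebraicClosure F)),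
        (y : AlgebraicClosure F) = x → ((τ y : separableClosure F (AlgebraicClosure F)) :
          AlgebraicClosure F) = (ψ.symm (Ψ τ) x : L) := by
  have hL : L ≤ separableClosure F (AlgebraicClosure F) := le_separableClosure F _ L
  let M := IntermediateField.restrict hL
  let e : L ≃ₐ[F] M := IntermediateField.restrictAlgEquiv hL
  have : IsGalois F M := IsGalois.of_algEquiv e
  let r : Gal(separableClosure F (AlgebraicClosure F)/F) →* Gal(M/F) :=
    AlgEquiv.restrictNormalHom M
  have hr : Function.Surjective r := AlgEquiv.restrictNormalHom_surjective _
  let ψ' : Gal(M/F) ≃* E := (AlgEquiv.autCongr e).symm.trans ψ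
  let Ψ : Gal(separableClosure F (AlgebraicClosure F)/F) →* E := ψ'.toMonoidHom.comp r
  have hΨ : Function.Surjective Ψ := ψ'.surjective.comp hr
  have hker : Ψ.ker = M.fixingSubgroup := by
    rw [← IntermediateField.restrictNormalHom_ker]
    ext τ
    exact ψ'.map_eq_one_iff
  refine ⟨Ψ, hΨ, ?_, fun τ x y hxy => ?_⟩
  · have hfin : Ψ.ker.FiniteIndex := ⟨by
      rw [Subgroup.index_ker]
      exact Nat.card_pos.ne'⟩
    refine Subgroup.isOpen_of_isClosed_of_finiteIndex _ ?_
    rw [hker]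
    exact InfiniteGalois.fixingSubgroup_isClosed M
  · have h1 : ψ.symm (Ψ τ) = (AlgEquiv.autCongr e).symm (r τ) := by
      rw [MulEquiv.symm_apply_eq]
      rfl
    rw [h1]
    have hy : y = (e x : M) := Subtype.ext hxy
    have h2 : τ y = (r τ (e x) : M) := by
      rw [hy]
      exact (AlgEquiv.restrictNormalHom_apply M τ (e x)).symm
    rw [h2]
    have h3 : e ((AlgEquiv.autCongr e).symm (r τ) x) = r τ (e x) := by
      change e (e.symm (r τ (e x))) = r τ (e x)
      exact e.apply_symm_apply _
    rw [← h3]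
    rfl

/-- The fixed field of the kernel of a surjection from the Galois group of the separable closure,
as a subextension of the algebraic closure. -/
theorem exists_isGalois_of_hom {E : Type*} [Group E]
    (Φ : Gal(separableClosure F (AlgebraicClosure F)/F) →* E) (hΦ : Function.Surjective Φ)
    (hopen : IsOpen (Φ.ker : Set Gal(separableClosure F (AlgebraicClosure F)/F))) :
    IsGalois F (IntermediateField.lift (IntermediateField.fixedField Φ.ker)) ∧
      ∃ ψ : Gal(IntermediateField.lift (IntermediateField.fixedField Φ.ker)/F) ≃* E,
        ∀ (τ) (x : IntermediateField.lift (IntermediateField.fixedField Φ.ker))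
          (y : separableClosure F (AlgebraicClosure F)),
          (y : AlgebraicClosure F) = x → ((τ y : separableClosure F (AlgebraicClosure F)) :
            AlgebraicClosure F) = (ψ.symm (Φ τ) x :
              IntermediateField.lift (IntermediateField.fixedField Φ.ker)) := by
  let M := IntermediateField.fixedField Φ.ker
  let e : M ≃ₐ[F] IntermediateField.lift M := IntermediateField.liftAlgEquiv M
  have hM : IsGalois F M := IsGalois.of_fixedField_normal_subgroup _
  let r : Gal(separableClosure F (AlgebraicClosure F)/F) →* Gal(M/F) :=
    AlgEquiv.restrictNormalHom M
  have hr : Function.Surjective r := AlgEquiv.restrictNormalHom_surjective _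
  have hker : r.ker = Φ.ker := by
    rw [IntermediateField.restrictNormalHom_ker]
    exact InfiniteGalois.fixingSubgroup_fixedField
      ⟨Φ.ker, Φ.ker.isClosed_of_isOpen hopen⟩
  obtain ⟨ψ', hψ'⟩ := exists_mulEquiv_of_ker_eq hr hΦ hker
  refine ⟨IsGalois.of_algEquiv e, (AlgEquiv.autCongr e).symm.trans ψ', fun τ x y hxy => ?_⟩
  have h1 : ((AlgEquiv.autCongr e).symm.trans ψ').symm (Φ τ) = AlgEquiv.autCongr e (r τ) := by
    rw [MulEquiv.symm_apply_eq, ← hψ']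
    exact congrArg ψ' ((AlgEquiv.autCongr e).symm_apply_apply (r τ)).symm
  rw [h1]
  have hx : y = (e.symm x : M) := by
    apply Subtype.ext
    have h2 : e (e.symm x) = x := e.apply_symm_apply x
    have h3 : ((e (e.symm x) : IntermediateField.lift M) : AlgebraicClosure F) = x :=
      congrArg _ h2
    exact hxy.trans h3.symm
  rw [hx, ← AlgEquiv.restrictNormalHom_apply M τ (e.symm x)]
  rfl

end Translation

theorem natCast_pow_le_encard {p k : ℕ} [Fact p.Prime] {α : Type*} {A : Set α}
    (f : (Fin k → ZMod p) → α) (hf : Function.Injective f) (hA : ∀ c, f c ∈ A) :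
    ((p ^ k : ℕ) : ℕ∞) ≤ A.encard := by
  have h1 : Set.range f ⊆ A := Set.range_subset_iff.2 hA
  have h2 : ENat.card (Fin k → ZMod p) = ((p ^ k : ℕ) : ℕ∞) := by
    rw [ENat.card_eq_coe_fintype_card, Fintype.card_fun, ZMod.card, Fintype.card_fin]
  rw [← h2]
  exact hf.encard_range.trans (Set.encard_le_encard h1)

theorem injective_lift_fixedField_ker {F : Type u} [Field F] {E ι : Type*} [Group E]
    {Φ : ι → (Gal(separableClosure F (AlgebraicClosure F)/F) →* E)}
    (hopen : ∀ c, IsOpen ((Φ c).ker : Set Gal(separableClosure F (AlgebraicClosure F)/F)))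
    (hinj : Function.Injective fun c => (Φ c).ker) :
    Function.Injective fun c =>
      IntermediateField.lift (IntermediateField.fixedField (Φ c).ker) := by
  intro c c' h
  have h1 := IntermediateField.lift_injective _ h
  have h2 : ∀ c, (IntermediateField.fixedField (Φ c).ker).fixingSubgroup = (Φ c).ker := fun c =>
    InfiniteGalois.fixingSubgroup_fixedField ⟨_, (Φ c).ker.isClosed_of_isOpen (hopen c)⟩
  apply hinj
  change (Φ c).ker = (Φ c').ker
  rw [← h2 c, h1, h2 c']

theorem theorem1p1 (p n k : ℕ) (hp : p.Prime) (hn : 1 ≤ n) (hn2 : p = 2 → 2 ≤ n) :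
    ((p ^ k : ℕ) : ℕ∞) ≤
        realizationMultiplicity.{u, 0} (FreeModuleSemidirect (ZMod p) (CyclicPPow p n) k) ∧
      ∀ (F : Type u) [Field F] (K : IntermediateField F (AlgebraicClosure F)) [IsGalois F K]
        (φ : Gal(K/F) ≃* CyclicPPow p n),
        (∃ L, SolvesEmbeddingProblem
          (SemidirectProduct.rightHom :
            FreeModuleSemidirect (ZMod p) (CyclicPPow p n) k →* CyclicPPow p n) K φ L) →
        ((p ^ k : ℕ) : ℕ∞) ≤
          Set.encard {L | SolvesEmbeddingProblem
            (SemidirectProduct.rightHom :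
              FreeModuleSemidirect (ZMod p) (CyclicPPow p n) k →* CyclicPPow p n) K φ L} := by
  have : Fact p.Prime := ⟨hp⟩
  have : NeZero (p ^ n) := ⟨pow_ne_zero _ hp.ne_zero⟩
  have hfin := finite_freeModuleSemidirect p (CyclicPPow p n) k
  refine ⟨le_sInf ?_, ?_⟩
  · rintro m ⟨F, _, hF, rfl⟩
    obtain ⟨L, hL, ⟨ψ⟩⟩ := Set.one_le_encard_iff_nonempty.1 hF
    have : IsSepClosed (separableClosure F (AlgebraicClosure F)) := IsSepClosure.sep_closed F
    obtain ⟨Ψ, hΨ, hopen, -⟩ := exists_hom_of_isGalois L ψ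
    obtain ⟨Φ, -, hsurj, hopen, hinj⟩ := exists_family_of_surjective hn hn2 Ψ hΨ hopen
    refine natCast_pow_le_encard _ (injective_lift_fixedField_ker hopen hinj) fun c => ?_
    obtain ⟨h1, ψ', -⟩ := exists_isGalois_of_hom (Φ c) (hsurj c) (hopen c)
    exact ⟨h1, ⟨ψ'⟩⟩
  · rintro F _ K _ φ ⟨L, hL, hKL, ψ, hψ⟩
    have : IsSepClosed (separableClosure F (AlgebraicClosure F)) := IsSepClosure.sep_closed F
    obtain ⟨Ψ, hΨ, hopen, hΨL⟩ := exists_hom_of_isGalois L ψ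
    obtain ⟨Φ, hright, hsurj, hopen, hinj⟩ := exists_family_of_surjective hn hn2 Ψ hΨ hopen
    have hKS : K ≤ separableClosure F (AlgebraicClosure F) := le_separableClosure F _ K
    -- The action on `K` depends only on the right component, which all `Φ c` share with `Ψ`; so
    -- every twisted field contains `K` and induces `φ`.
    have hact : ∀ τ (x : K), ((τ (IntermediateField.inclusion hKS x) :
        separableClosure F (AlgebraicClosure F)) : AlgebraicClosure F) =
          (φ.symm (Ψ τ).right x : K) := by
      intro τ x
      rw [hΨL τ (IntermediateField.inclusion hKL x) (IntermediateField.inclusion hKS x) rfl, hψ,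
        MulEquiv.apply_symm_apply]
      rfl
    refine natCast_pow_le_encard _ (injective_lift_fixedField_ker hopen hinj) fun c => ?_
    obtain ⟨h1, ψ', hψ'⟩ := exists_isGalois_of_hom (Φ c) (hsurj c) (hopen c)
    have hK : K ≤ IntermediateField.lift (IntermediateField.fixedField (Φ c).ker) := by
      intro x hx
      have hfix : IntermediateField.inclusion hKS ⟨x, hx⟩ ∈
          IntermediateField.fixedField (Φ c).ker := by
        rw [IntermediateField.mem_fixedField_iff]
        intro τ hτ
        apply Subtype.ext
        rw [hact, ← hright c, show Φ c τ = 1 from hτ, SemidirectProduct.one_right, map_one]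
        rfl
      exact (IntermediateField.mem_lift (IntermediateField.inclusion hKS ⟨x, hx⟩)).2 hfix
    refine ⟨h1, hK, ψ', fun τ x => ?_⟩
    obtain ⟨σ, hσ⟩ := hsurj c (ψ' τ)
    have hτ : τ = ψ'.symm (Φ c σ) := by rw [hσ, MulEquiv.symm_apply_apply]
    apply Subtype.ext
    rw [hτ, ← hψ' σ (IntermediateField.inclusion hK x) (IntermediateField.inclusion hKS x) rfl,
      hact, MulEquiv.apply_symm_apply, SemidirectProduct.rightHom_eq_right, hright]
    rfl
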